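/- Let $\alpha$ be an infinite set and let $G$ be the semigroup (under composition) of all finite transformations of $\alpha$, i.e. maps $\tau:\alpha\to\alpha$ with $\{i:\tau(i)\ne i\}$ finite. A \emph{polyadic Heyting algebra} of dimension $\alpha$ ($GPHA_\alpha$) is an algebra $(A,\vee,\wedge,\to,0,\mathsf s_\tau,\mathsf c_{(J)},\mathsf q_{(J)})_{\tau\in G,\ J\subseteq\alpha\text{ finite}}$ such that $(A,\vee,\wedge,\to,0)$ is a Heyting algebra, each $\mathsf s_\tau$ is a Heyting endomorphism, each $\mathsf c_{(J)}$ is an existential quantifier ($\exists 0=0$, $p\le\exists p$, $\exists(p\wedge\exists r)=\exists p\wedge\exists r$, $\exists(\exists p\to\exists r)=\exists p\to\exists r$, $\exists(\exists p\vee\exists r)=\exists p\vee\exists r$, $\exists\exists p=\exists p$), each $\mathsf q_{(J)}$ is a universal quantifier ($\forall 1=1$, $\forall p\le p$, $\forall(p\to r)\le\forall p\to\forall r$, $\forall\forall p=\forall p$), and for all $p\in A$, $\sigma,\tau\in G$ and finite $J,J'\subseteq\alpha$: (1) $\mathsf s_{Id}p=p$; (2) $\mathsf s_{\sigma\circ\tau}p=\mathsf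 s_\sigma\mathsf s_\tau p$; (3) $\mathsf c_{(J\cup J')}p=\mathsf c_{(J)}\mathsf c_{(J')}p$ and $\mathsf q_{(J\cup J')}p=\mathsf q_{(J)}\mathsf q_{(J')}p$; (4) $\mathsf c_{(J)}\mathsf q_{(J)}p=\mathsf q_{(J)}p$ and $\mathsf q_{(J)}\mathsf c_{(J)}p=\mathsf c_{(J)}p$; (5) if $\sigma$ and $\tau$ agree on $\alpha\setminus J$, then $\mathsf s_\sigma\mathsf c_{(J)}p=\mathsf s_\tau\mathsf c_{(J)}p$ and $\mathsf s_\sigma\mathsf q_{(J)}p=\mathsf s_\tau\mathsf q_{(J)}p$; (6) if $\sigma$ is injective on $\sigma^{-1}(J)$, then $\mathsf c_{(J)}\mathsf s_\sigma p=\mathsf s_\sigma\mathsf c_{(\sigma^{-1}(J))}p$ and $\mathsf q_{(J)}\mathsf s_\sigma p=\mathsf s_\sigma\mathsf q_{(\sigma^{-1}(J))}p$. A \emph{polyadic Heyting algebra with equality} ($GPHAE_\alpha$) has in addition constants $\mathsf d_{kl}$ $(k,l\in\alpha)$ with $\mathsf d_{kk}=1$, $\mathsf s_\tau\mathsf d_{kl}=\mathsf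 d_{\tau(k)\tau(l)}$ and $p\wedge\mathsf d_{kl}\le\mathsf s_{[k|l]}p$ for all $p$, where $[k|l]$ sends $k$ to $l$ and fixes all other points. Let $L$ be $GPHA_\alpha$ or $GPHAE_\alpha$, let $\delta$ be an index set and let $\rho$ assign to each $\eta\in\delta$ a subset $\rho(\eta)\subseteq\alpha$ such that $\alpha\setminus\bigcup_{\eta\in S}\rho(\eta)$ is infinite for every finite $S\subseteq\delta$. Let $\mathfrak{Fr}$ be the absolutely free algebra of the similarity type of $L$ generated by $\delta$. The \emph{dimension-restricted free algebra} $\mathfrak A=\mathfrak{Fr}^{\rho}_{\delta}L$ is the quotient of $\mathfrak{Fr}$ by the intersection of all congruences $R$ such that $\mathfrak{Fr}/R\in L$ and $\mathsf c_{(\{k\})}\eta/R=\eta/R$ for all $\eta\in\delta$ and $k\in\alpha\setminus\rho(\eta)$. Let $X\subseteq A$ be the set of images of the generators $\eta\in\delta$. For $Y\subseteq A$ let $\mathfrak{Sg}\,Y$ be the subalgebra of $\mathfrak A$ generated by $Y$ (with respect to all operations of the type), and let $a\le b$ mean $a\wedge b=a$. \textbf{Theorem.} $\mathfrak A$ has the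 interpolation property: for all $X_1,X_2\subseteq X$ and all $\theta_1\in\mathfrak{Sg}\,X_1$, $\theta_2\in\mathfrak{Sg}\,X_2$ with $\theta_1\le\theta_2$, there is $\theta\in\mathfrak{Sg}(X_1\cap X_2)$ such that $\theta_1\le\theta\le\theta_2$. -/

import Mathlib

universe u v

/-- The finite transformations of `α` (maps `α → α` moving only finitely many points), as a
submonoid of all transformations of `α` under composition: `(σ * τ) i = σ (τ i)`. -/
def FinTrans (α : Type u) : Submonoid (Function.End α) where
  carrier := {τ | {i | τ i ≠ i}.Finite}
  one_mem' := by
    have h : {i : α | (1 : Function.End α) i ≠ i} = ∅ := by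
      ext i
      simp [Function.End.one_def]
    show Set.Finite {i : α | (1 : Function.End α) i ≠ i}
    rw [h]
    exact Set.finite_empty
  mul_mem' := by
    intro σ τ hσ hτ
    refine (hσ.union hτ).subset ?_
    intro i hi
    by_contra hcon
    simp only [Set.mem_union, Set.mem_ofPred_eq, not_or, not_not] at hcon
    apply hi
    show σ (τ i) = i
    rw [hcon.2, hcon.1]

/-- The underlying map of a finite transformation. -/
def finApp {α : Type u} (τ : FinTrans α) : α → α := τ.1

open Classical in
/-- The replacement `[k|l]`: it sends `k` to `l` and fixes every other point. -/
noncomputable def FinTrans.repl {α : Type u} (k l : α) : FinTrans α :=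
  ⟨(fun i => if i = k then l else i : α → α), by
    refine (Set.finite_singleton k).subset ?_
    intro i hi
    by_contra hik
    apply hi
    show (if i = k then l else i) = i
    exact if_neg hik⟩

/-- Algebras of the similarity type of polyadic Heyting algebras of dimension `α` over the finite
transformations, with carrier `A`: join, meet, implication, zero, substitutions `s τ`,
cylindrifiers `c J` and their duals `q J` for finite `J ⊆ α`. If `e = true` the type also has the
diagonal constants `d i j`; if `e = false` it has none. No laws are imposed here. -/
structure PolyAlg (e : Bool) (α : Type u) (A : Type v) where
  join : A → A → A
  meet : A → A → A
  imp : A → A → A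
  zero : A
  s : FinTrans α → A → A
  c : Finset α → A → A
  q : Finset α → A → A
  d : e = true → α → α → A

namespace PolyAlg

variable {e : Bool} {α : Type u} {A : Type v}

/-- The lattice order: `a ≤ b` iff `a ∧ b = a`. -/
def le (𝔄 : PolyAlg e α A) (a b : A) : Prop := 𝔄.meet a b = a

/-- The unit `1 = 0 → 0`. -/
def one (𝔄 : PolyAlg e α A) : A := 𝔄.imp 𝔄.zero 𝔄.zero

/-- `(A, ∨, ∧, →, 0)` is a Heyting algebra. -/
def IsHeyting (𝔄 : PolyAlg e α A) : Prop :=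
  ∃ _ : HeytingAlgebra A, (∀ a b : A, 𝔄.join a b = a ⊔ b) ∧ (∀ a b : A, 𝔄.meet a b = a ⊓ b) ∧
    (∀ a b : A, 𝔄.imp a b = a ⇨ b) ∧ 𝔄.zero = (⊥ : A)

/-- `f` is an endomorphism of `(A, ∨, ∧, →, 0)`. -/
structure IsHeytingEnd (𝔄 : PolyAlg e α A) (f : A → A) : Prop where
  join : ∀ p r, f (𝔄.join p r) = 𝔄.join (f p) (f r)
  meet : ∀ p r, f (𝔄.meet p r) = 𝔄.meet (f p) (f r)
  imp : ∀ p r, f (𝔄.imp p r) = 𝔄.imp (f p) (f r)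
  zero : f 𝔄.zero = 𝔄.zero

/-- `E` is an existential quantifier on the Heyting reduct. -/
structure IsExistential (𝔄 : PolyAlg e α A) (E : A → A) : Prop where
  zero : E 𝔄.zero = 𝔄.zero
  le : ∀ p, 𝔄.le p (E p)
  meet : ∀ p r, E (𝔄.meet p (E r)) = 𝔄.meet (E p) (E r)
  imp : ∀ p r, E (𝔄.imp (E p) (E r)) = 𝔄.imp (E p) (E r)
  join : ∀ p r, E (𝔄.join (E p) (E r)) = 𝔄.join (E p) (E r)
  idem : ∀ p, E (E p) = E p

/-- `U` is a universal quantifier on the Heyting reduct. -/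
structure IsUniversal (𝔄 : PolyAlg e α A) (U : A → A) : Prop where
  one : U 𝔄.one = 𝔄.one
  le : ∀ p, 𝔄.le (U p) p
  imp : ∀ p r, 𝔄.le (U (𝔄.imp p r)) (𝔄.imp (U p) (U r))
  idem : ∀ p, U (U p) = U p

open Classical in
/-- `𝔄` is a polyadic Heyting algebra of dimension `α` over the finite transformations
(`e = false`), respectively a polyadic Heyting algebra with equality (`e = true`).
In `c_s` and `q_s` the hypothesis says that `σ` is injective on `σ⁻¹(J)`, and
`J.preimage (finApp σ) h` is the finite set `σ⁻¹(J)`. -/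
structure IsGPHA (𝔄 : PolyAlg e α A) : Prop where
  heyting : 𝔄.IsHeyting
  s_end : ∀ τ, 𝔄.IsHeytingEnd (𝔄.s τ)
  c_ex : ∀ J, 𝔄.IsExistential (𝔄.c J)
  q_univ : ∀ J, 𝔄.IsUniversal (𝔄.q J)
  s_one : ∀ p, 𝔄.s 1 p = p
  s_mul : ∀ σ τ p, 𝔄.s (σ * τ) p = 𝔄.s σ (𝔄.s τ p)
  c_union : ∀ J J' p, 𝔄.c (J ∪ J') p = 𝔄.c J (𝔄.c J' p)
  q_union : ∀ J J' p, 𝔄.q (J ∪ J') p = 𝔄.q J (𝔄.q J' p)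
  c_q : ∀ J p, 𝔄.c J (𝔄.q J p) = 𝔄.q J p
  q_c : ∀ J p, 𝔄.q J (𝔄.c J p) = 𝔄.c J p
  s_c : ∀ (σ τ : FinTrans α) (J : Finset α) (p : A), (∀ i, i ∉ J → finApp σ i = finApp τ i) →
    𝔄.s σ (𝔄.c J p) = 𝔄.s τ (𝔄.c J p)
  s_q : ∀ (σ τ : FinTrans α) (J : Finset α) (p : A), (∀ i, i ∉ J → finApp σ i = finApp τ i) →
    𝔄.s σ (𝔄.q J p) = 𝔄.s τ (𝔄.q J p)
  c_s : ∀ (σ : FinTrans α) (J : Finset α) (p : A)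
      (h : Set.InjOn (finApp σ) (finApp σ ⁻¹' (J : Set α))),
    𝔄.c J (𝔄.s σ p) = 𝔄.s σ (𝔄.c (J.preimage (finApp σ) h) p)
  q_s : ∀ (σ : FinTrans α) (J : Finset α) (p : A)
      (h : Set.InjOn (finApp σ) (finApp σ ⁻¹' (J : Set α))),
    𝔄.q J (𝔄.s σ p) = 𝔄.s σ (𝔄.q (J.preimage (finApp σ) h) p)
  d_refl : ∀ (he : e = true) (k : α), 𝔄.d he k k = 𝔄.one
  s_d : ∀ (he : e = true) (τ : FinTrans α) (k l : α),
    𝔄.s τ (𝔄.d he k l) = 𝔄.d he (finApp τ k) (finApp τ l)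
  d_le : ∀ (he : e = true) (k l : α) (p : A),
    𝔄.le (𝔄.meet p (𝔄.d he k l)) (𝔄.s (FinTrans.repl k l) p)

/-- `𝔄.Sg X` is the subalgebra generated by `X` (its universe): the smallest subset that
contains `X` and is closed under all operations of `𝔄`, constants included. -/
inductive Sg (𝔄 : PolyAlg e α A) (X : Set A) : Set A
  | of (x : A) : x ∈ X → Sg 𝔄 X x
  | join (a b : A) : Sg 𝔄 X a → Sg 𝔄 X b → Sg 𝔄 X (𝔄.join a b)
  | meet (a b : A) : Sg 𝔄 X a → Sg 𝔄 X b → Sg 𝔄 X (𝔄.meet a b)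
  | imp (a b : A) : Sg 𝔄 X a → Sg 𝔄 X b → Sg 𝔄 X (𝔄.imp a b)
  | zero : Sg 𝔄 X 𝔄.zero
  | s (τ : FinTrans α) (a : A) : Sg 𝔄 X a → Sg 𝔄 X (𝔄.s τ a)
  | c (J : Finset α) (a : A) : Sg 𝔄 X a → Sg 𝔄 X (𝔄.c J a)
  | q (J : Finset α) (a : A) : Sg 𝔄 X a → Sg 𝔄 X (𝔄.q J a)
  | d (he : e = true) (i j : α) : Sg 𝔄 X (𝔄.d he i j)

/-- `R` is a congruence relation of `𝔄`. -/
structure IsCon (𝔄 : PolyAlg e α A) (R : Setoid A) : Prop where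
  join : ∀ a a' b b', R a a' → R b b' → R (𝔄.join a b) (𝔄.join a' b')
  meet : ∀ a a' b b', R a a' → R b b' → R (𝔄.meet a b) (𝔄.meet a' b')
  imp : ∀ a a' b b', R a a' → R b b' → R (𝔄.imp a b) (𝔄.imp a' b')
  s : ∀ τ a a', R a a' → R (𝔄.s τ a) (𝔄.s τ a')
  c : ∀ J a a', R a a' → R (𝔄.c J a) (𝔄.c J a')
  q : ∀ J a a', R a a' → R (𝔄.q J a) (𝔄.q J a')

/-- The quotient algebra `𝔄 / R`. -/
def quot (𝔄 : PolyAlg e α A) (R : Setoid A) (h : 𝔄.IsCon R) : PolyAlg e α (Quotient R) where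
  join := Quotient.map₂ 𝔄.join (fun _ _ ha _ _ hb => h.join _ _ _ _ ha hb)
  meet := Quotient.map₂ 𝔄.meet (fun _ _ ha _ _ hb => h.meet _ _ _ _ ha hb)
  imp := Quotient.map₂ 𝔄.imp (fun _ _ ha _ _ hb => h.imp _ _ _ _ ha hb)
  zero := Quotient.mk R 𝔄.zero
  s τ := Quotient.map (𝔄.s τ) (fun _ _ ha => h.s τ _ _ ha)
  c J := Quotient.map (𝔄.c J) (fun _ _ ha => h.c J _ _ ha)
  q J := Quotient.map (𝔄.q J) (fun _ _ ha => h.q J _ _ ha)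
  d he i j := Quotient.mk R (𝔄.d he i j)

end PolyAlg

/-- Words of the similarity type over the set of variables `δ`. -/
inductive PolyWord (e : Bool) (α : Type u) (δ : Type v) : Type (max u v)
  | var (η : δ) : PolyWord e α δ
  | join (a b : PolyWord e α δ) : PolyWord e α δ
  | meet (a b : PolyWord e α δ) : PolyWord e α δ
  | imp (a b : PolyWord e α δ) : PolyWord e α δ
  | zero : PolyWord e α δ
  | s (τ : FinTrans α) (a : PolyWord e α δ) : PolyWord e α δ
  | c (J : Finset α) (a : PolyWord e α δ) : PolyWord e α δ
  | q (J : Finset α) (a : PolyWord e α δ) : PolyWord e α δ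
  | d (he : e = true) (i j : α) : PolyWord e α δ

/-- The absolutely free algebra on `δ` generators. -/
def absFree (e : Bool) (α : Type u) (δ : Type v) : PolyAlg e α (PolyWord e α δ) where
  join := .join
  meet := .meet
  imp := .imp
  zero := .zero
  s := .s
  c := .c
  q := .q
  d := .d

section DimensionRestrictedFree

variable (e : Bool) {α : Type u} {δ : Type v} (ρ : δ → Set α)

/-- The congruences `R` of the absolutely free algebra such that the quotient by `R` is a polyadic
Heyting algebra (with equality if `e = true`) and `c_k η / R = η / R` for every generator `η` and
every `k ∉ ρ η`. The class of polyadic Heyting algebras is equational, hence closed under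
subalgebras and direct products, so asking for the quotient to be in `SP` of it is the same. -/
def IsRestrictedCon (R : Setoid (PolyWord e α δ)) : Prop :=
  ∃ h : (absFree e α δ).IsCon R, ((absFree e α δ).quot R h).IsGPHA ∧
    ∀ (η : δ) (k : α), k ∉ ρ η → R (PolyWord.c {k} (PolyWord.var η)) (PolyWord.var η)

/-- The intersection of all congruences as in `IsRestrictedCon`. -/
def restrictedCr : Setoid (PolyWord e α δ) := sInf {R | IsRestrictedCon e ρ R}

theorem restrictedCr_isCon : (absFree e α δ).IsCon (restrictedCr e ρ) where
  join a a' b b' ha hb := fun R hR => by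
    obtain ⟨h, _⟩ := id hR
    exact h.join _ _ _ _ (ha R hR) (hb R hR)
  meet a a' b b' ha hb := fun R hR => by
    obtain ⟨h, _⟩ := id hR
    exact h.meet _ _ _ _ (ha R hR) (hb R hR)
  imp a a' b b' ha hb := fun R hR => by
    obtain ⟨h, _⟩ := id hR
    exact h.imp _ _ _ _ (ha R hR) (hb R hR)
  s τ a a' ha := fun R hR => by
    obtain ⟨h, _⟩ := id hR
    exact h.s _ _ _ (ha R hR)
  c J a a' ha := fun R hR => by
    obtain ⟨h, _⟩ := id hR
    exact h.c _ _ _ (ha R hR)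
  q J a a' ha := fun R hR => by
    obtain ⟨h, _⟩ := id hR
    exact h.q _ _ _ (ha R hR)

/-- The carrier of the dimension-restricted free algebra with generators indexed by `δ` and
dimension restricting function `ρ`. -/
def DimFree : Type (max u v) := Quotient (restrictedCr e ρ)

/-- The dimension-restricted free algebra: without equality if `e = false`, with equality if
`e = true`. -/
def dimFree : PolyAlg e α (DimFree e ρ) :=
  (absFree e α δ).quot (restrictedCr e ρ) (restrictedCr_isCon e ρ)

/-- The free generators of the dimension-restricted free algebra. -/
def DimFree.gen (η : δ) : DimFree e ρ := Quotient.mk (restrictedCr e ρ) (PolyWord.var η)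

end DimensionRestrictedFree

/-!
Over a subalgebra `S` of a Heyting algebra `H`, let a sequent with sides in two copies of `H` hold
if it has an interpolant in `S`. These sequents obey all rules of intuitionistic logic, so both
copies of `H` embed, agreeing on `S`, into a frame in which an inequality between an element of one
copy and an element of the other holds only if it has an interpolant.

In a polyadic algebra where any finitely many elements leave infinitely many coordinates free,
bound variables can be renamed to fresh ones, so in this frame the quantifiers become suprema and
infima of substitution instances. Hence `a ↦ (σ ↦ s σ a)` maps each copy homomorphically into a
functional polyadic algebra, which satisfies the laws because all suprema and infima exist.

For the free algebra and `S = Sg (X₁ ∩ X₂)`, freeness provides a homomorphism that agrees with the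
first copy on `X₁` and with the second on `X₂`. It sends `θ₁ ≤ θ₂` to an inequality between the
two copies, which therefore has an interpolant.
-/

/-! ### Amalgamation over a Heyting subalgebra -/

/-- A Heyting subalgebra of `H`; over one of them two copies of `H` are amalgamated. -/
structure HeytingSubalgebra (H : Type*) [HeytingAlgebra H] extends Sublattice H where
  bot_mem' : ⊥ ∈ carrier
  himp_mem' : ∀ {a b}, a ∈ carrier → b ∈ carrier → a ⇨ b ∈ carrier

/-- A pair of adjoint quantifiers on a Heyting algebra: `c a` and `q a` are the best
approximations of `a` from above and from below by fixed points of `c`, and these are closed under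
`⊓` and `⇨`. -/
structure IsQuantifierPair {H : Type*} [HeytingAlgebra H] (c q : H → H) : Prop where
  le_c : ∀ a, a ≤ c a
  c_le : ∀ a t, c t = t → a ≤ t → c a ≤ t
  c_c : ∀ a, c (c a) = c a
  q_le : ∀ a, q a ≤ a
  le_q : ∀ a t, c t = t → t ≤ a → t ≤ q a
  c_q : ∀ a, c (q a) = q a
  inf : ∀ a b, c a = a → c b = b → c (a ⊓ b) = a ⊓ b
  himp : ∀ a b, c a = a → c b = b → c (a ⇨ b) = a ⇨ b

/-- The sublocale generated by a set of elements of a frame. It consists of the `U` that are the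
largest `Z` with `Z ⊓ (U ⇨ K) ≤ K` for all generators `K`. -/
def generatedSublocale {L : Type*} [Order.Frame L] (𝒦 : Set L) : Sublocale L where
  carrier := {U | ∀ Z, (∀ K ∈ 𝒦, Z ⊓ (U ⇨ K) ≤ K) → Z ≤ U}
  sInf_mem' s hs Z hZ := le_sInf fun U hU => hs hU Z fun K hK =>
    (inf_le_inf_left Z (himp_le_himp_right (sInf_le hU))).trans (hZ K hK)
  himp_mem' a b hb Z hZ := by
    refine le_himp_iff.2 (hb _ fun K hK => le_trans ?_ (hZ K hK))
    rw [inf_assoc]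
    refine inf_le_inf_left Z (le_himp_iff.2 ?_)
    calc a ⊓ (b ⇨ K) ⊓ (a ⇨ b) = (b ⇨ K) ⊓ (a ⊓ (a ⇨ b)) := by ac_rfl
      _ ≤ (b ⇨ K) ⊓ b := inf_le_inf_left _ inf_himp_le
      _ ≤ K := himp_inf_le

theorem subset_generatedSublocale {L : Type*} [Order.Frame L] (𝒦 : Set L) :
    𝒦 ⊆ generatedSublocale 𝒦 := fun K hK Z hZ => by simpa using hZ K hK

namespace HeytingSubalgebra

variable {H : Type*} [HeytingAlgebra H]

instance : SetLike (HeytingSubalgebra H) H where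
  coe S := S.carrier
  coe_injective := by
    rintro ⟨⟨_, _, _⟩, _, _⟩ ⟨⟨_, _, _⟩, _, _⟩ rfl
    rfl

variable {S : HeytingSubalgebra H} {x y t a a' i : H}

theorem bot_mem : ⊥ ∈ S := S.bot_mem'

theorem sup_mem (ha : a ∈ S) (hi : i ∈ S) : a ⊔ i ∈ S := S.supClosed' ha hi

theorem inf_mem (ha : a ∈ S) (hi : i ∈ S) : a ⊓ i ∈ S := S.infClosed' ha hi

theorem himp_mem (ha : a ∈ S) (hi : i ∈ S) : a ⇨ i ∈ S := S.himp_mem' ha hi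

theorem top_mem : ⊤ ∈ S := by simpa using himp_mem (bot_mem (S := S)) bot_mem

variable (S) in
/-- The sequent with `x` and `t` on one side of the amalgam over `S` and `y` on the other entails
`t`: the part `y` can be replaced by an interpolant in `S`. -/
def Entails (x y t : H) : Prop := ∃ i ∈ S, y ≤ i ∧ x ⊓ i ≤ t

namespace Entails

theorem mono {x' y' t' : H} (h : S.Entails x y t) (hx : x' ≤ x) (hy : y' ≤ y) (ht : t ≤ t') :
    S.Entails x' y' t' := by
  obtain ⟨i, hi, hyi, hit⟩ := h
  exact ⟨i, hi, hy.trans hyi, (inf_le_inf_right i hx).trans (hit.trans ht)⟩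

theorem of_le (h : x ≤ t) : S.Entails x y t := ⟨⊤, top_mem, le_top, inf_le_left.trans h⟩

theorem inf (h : S.Entails x y t) (h' : S.Entails x y a) : S.Entails x y (t ⊓ a) := by
  obtain ⟨i, hi, hyi, hit⟩ := h
  obtain ⟨j, hj, hyj, hja⟩ := h'
  exact ⟨i ⊓ j, inf_mem hi hj, le_inf hyi hyj, le_inf
    ((inf_le_inf_left x inf_le_left).trans hit) ((inf_le_inf_left x inf_le_right).trans hja)⟩

theorem himp_iff : S.Entails x y (a ⇨ t) ↔ S.Entails (x ⊓ a) y t := by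
  simp only [Entails, le_himp_iff, inf_right_comm]

theorem cut (h : S.Entails x y a) (h' : S.Entails (x ⊓ a) y t) : S.Entails x y t :=
  (h.inf (himp_iff.2 h')).mono le_rfl le_rfl inf_himp_le

theorem cut_right (h : S.Entails x y a) (h' : S.Entails y (x ⊓ a) t) : S.Entails y x t := by
  obtain ⟨i, hi, hyi, hia⟩ := h
  obtain ⟨j, hj, hxj, hjt⟩ := h'
  refine ⟨i ⇨ j, himp_mem hi hj, le_himp_iff.2 ((le_inf inf_le_left hia).trans hxj), ?_⟩
  calc y ⊓ (i ⇨ j) ≤ y ⊓ (i ⊓ (i ⇨ j)) := le_inf inf_le_left (inf_le_inf_right _ hyi)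
    _ ≤ y ⊓ j := inf_le_inf_left y inf_himp_le
    _ ≤ t := hjt

theorem swap (ha : a ∈ S) (h : S.Entails x y a) : S.Entails y x a :=
  h.cut_right ⟨a, ha, inf_le_right, inf_le_right⟩

theorem sup_left (h : S.Entails (x ⊓ a) y t) (h' : S.Entails (x ⊓ a') y t) :
    S.Entails (x ⊓ (a ⊔ a')) y t := by
  obtain ⟨i, hi, hyi, hit⟩ := h
  obtain ⟨j, hj, hyj, hjt⟩ := h'
  refine ⟨i ⊓ j, inf_mem hi hj, le_inf hyi hyj, ?_⟩
  rw [inf_sup_left, inf_sup_right]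
  exact sup_le ((inf_le_inf_left _ inf_le_left).trans hit)
    ((inf_le_inf_left _ inf_le_right).trans hjt)

theorem sup_right (h : S.Entails y (x ⊓ a) t) (h' : S.Entails y (x ⊓ a') t) :
    S.Entails y (x ⊓ (a ⊔ a')) t := by
  obtain ⟨i, hi, hxi, hit⟩ := h
  obtain ⟨j, hj, hxj, hjt⟩ := h'
  refine ⟨i ⊔ j, sup_mem hi hj, ?_, ?_⟩ <;> rw [inf_sup_left]
  exacts [sup_le_sup hxi hxj, sup_le hit hjt]

theorem quantifier_left {c q : H → H} (hQ : IsQuantifierPair c q) (hS : ∀ i ∈ S, q i ∈ S)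
    (hx : c x = x) (hy : c y = y) (ht : c t = t) (h : S.Entails (x ⊓ a) y t) :
    S.Entails (x ⊓ c a) y t := by
  obtain ⟨i, hi, hyi, hit⟩ := h
  refine ⟨q i, hS i hi, hQ.le_q _ _ hy hyi, ?_⟩
  rw [inf_right_comm, inf_comm, ← le_himp_iff]
  refine hQ.c_le _ _ (hQ.himp _ _ (hQ.inf _ _ hx (hQ.c_q i)) ht) (le_himp_iff.2 ?_)
  rw [inf_comm, inf_right_comm]
  exact (inf_le_inf_left _ (hQ.q_le i)).trans hit

theorem quantifier_right {c q : H → H} (hQ : IsQuantifierPair c q) (hS : ∀ i ∈ S, c i ∈ S)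
    (hx : c x = x) (hy : c y = y) (ht : c t = t) (h : S.Entails y (x ⊓ a) t) :
    S.Entails y (x ⊓ c a) t := by
  obtain ⟨i, hi, hxi, hit⟩ := h
  refine ⟨c i, hS i hi, ?_, ?_⟩
  · rw [inf_comm, ← le_himp_iff] at hxi ⊢
    exact hQ.c_le _ _ (hQ.himp _ _ hx (hQ.c_c i)) (hxi.trans (himp_le_himp_left (hQ.le_c i)))
  · rw [inf_comm, ← le_himp_iff] at hit ⊢
    exact hQ.c_le _ _ (hQ.himp _ _ hy ht) hit

end Entails

variable (S)

/-- The sequents `x : Bool → H`, with `x b` and `x !b` on the two sides, that entail the element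
`a` of side `b`. -/
def amalgamLower (b : Bool) (a : H) : LowerSet (Bool → H) where
  carrier := {x | S.Entails (x b) (x !b) a}
  lower' _ _ hyx hx := hx.mono (hyx b) (hyx !b) le_rfl

theorem mem_amalgamLower {b : Bool} {w : Bool → H} :
    w ∈ S.amalgamLower b a ↔ S.Entails (w b) (w !b) a := Iff.rfl

/-- The amalgam of two copies of `H` over `S`, in which both copies of `H` are embedded so that
suitable joins and meets are preserved. -/
def amalgam : Sublocale (LowerSet (Bool → H)) :=
  generatedSublocale (Set.range fun p : Bool × H => S.amalgamLower p.1 p.2)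

/-- The element `a` of the copy `b` of `H`, as an element of the amalgam over `S`. -/
def amalgamOf (b : Bool) (a : H) : S.amalgam :=
  ⟨S.amalgamLower b a, subset_generatedSublocale _ ⟨(b, a), rfl⟩⟩

variable {S} {b : Bool}

theorem amalgamOf_mono (b : Bool) (h : a ≤ a') : S.amalgamOf b a ≤ S.amalgamOf b a' :=
  fun _ hx => hx.mono le_rfl le_rfl h

theorem update_inf_mem_of_mem_himp {U V : LowerSet (Bool → H)} {w : Bool → H}
    (hw : w ∈ U ⇨ V) (ha : S.amalgamLower b a ≤ U) : Function.update w b (w b ⊓ a) ∈ V := by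
  have hle : Function.update w b (w b ⊓ a) ≤ w :=
    update_le_iff.2 ⟨inf_le_left, fun _ _ => le_rfl⟩
  exact (himp_inf_le : (U ⇨ V) ⊓ U ≤ V)
    ⟨(U ⇨ V).lower hle hw, ha (Entails.of_le (by simp))⟩

/-- As in a sequent calculus, the left rules for `i` suffice: one for each side of the amalgam. -/
theorem amalgamOf_le_of_forall {U : S.amalgam}
    (hl : ∀ x y t, (∀ a, S.amalgamOf b a ≤ U → S.Entails (x ⊓ a) y t) → S.Entails (x ⊓ i) y t)
    (hr : ∀ x y t, (∀ a, S.amalgamOf b a ≤ U → S.Entails y (x ⊓ a) t) → S.Entails y (x ⊓ i) t) :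
    S.amalgamOf b i ≤ U := by
  refine U.2 _ ?_
  rintro _ ⟨⟨b', t⟩, rfl⟩ w ⟨hi, hw⟩
  have key (a : H) (ha : S.amalgamOf b a ≤ U) :
      Function.update w b (w b ⊓ a) ∈ S.amalgamLower b' t := update_inf_mem_of_mem_himp hw ha
  replace hi : S.Entails (w b) (w !b) i := hi
  change S.Entails (w b') (w !b') t
  rcases Bool.eq_or_eq_not b' b with rfl | rfl
  · exact hi.cut (hl _ _ _ fun a ha => by simpa [mem_amalgamLower] using key a ha)
  · rw [Bool.not_not]
    exact hi.cut_right (hr _ _ _ fun a ha => by simpa [mem_amalgamLower] using key a ha)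

variable (S)

theorem amalgamOf_inf (b : Bool) (a a' : H) :
    S.amalgamOf b (a ⊓ a') = S.amalgamOf b a ⊓ S.amalgamOf b a' :=
  le_antisymm (le_inf (amalgamOf_mono b inf_le_left) (amalgamOf_mono b inf_le_right))
    fun _ hx => Entails.inf hx.1 hx.2

theorem amalgamOf_bot (b : Bool) : S.amalgamOf b ⊥ = ⊥ :=
  le_bot_iff.1 (amalgamOf_le_of_forall (fun _ _ _ _ => Entails.of_le (by simp))
    fun _ _ _ _ => ⟨⊥, bot_mem, by simp, by simp⟩)

theorem amalgamOf_sup (b : Bool) (a a' : H) :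
    S.amalgamOf b (a ⊔ a') = S.amalgamOf b a ⊔ S.amalgamOf b a' :=
  le_antisymm
    (amalgamOf_le_of_forall (fun _ _ _ h => (h a le_sup_left).sup_left (h a' le_sup_right))
      fun _ _ _ h => (h a le_sup_left).sup_right (h a' le_sup_right))
    (sup_le (amalgamOf_mono b le_sup_left) (amalgamOf_mono b le_sup_right))

theorem amalgamOf_himp (b : Bool) (a a' : H) :
    S.amalgamOf b (a ⇨ a') = S.amalgamOf b a ⇨ S.amalgamOf b a' := by
  refine le_antisymm ?_ fun w hw => ?_
  · rw [le_himp_iff, ← amalgamOf_inf]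
    exact amalgamOf_mono b himp_inf_le
  · have h := update_inf_mem_of_mem_himp (V := S.amalgamLower b a') hw le_rfl
    exact Entails.himp_iff.2 (by simpa [mem_amalgamLower] using h)

/-- The embedding of the copy `b` of `H` into the amalgam over `S`. -/
def amalgamHom (b : Bool) : HeytingHom H S.amalgam where
  toFun := S.amalgamOf b
  map_sup' := S.amalgamOf_sup b
  map_inf' := S.amalgamOf_inf b
  map_bot' := S.amalgamOf_bot b
  map_himp' := S.amalgamOf_himp b

variable {S}

theorem amalgamHom_eq_of_mem (ha : a ∈ S) (b b' : Bool) :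
    S.amalgamHom b a = S.amalgamHom b' a := by
  have key (b : Bool) : S.amalgamOf b a ≤ S.amalgamOf (!b) a := fun w hw => by
    have : S.Entails (w !b) (w b) a := Entails.swap ha hw
    simpa [amalgamOf, mem_amalgamLower] using this
  rcases Bool.eq_or_eq_not b' b with rfl | rfl
  · rfl
  · exact le_antisymm (key b) ((key !b).trans_eq (by rw [Bool.not_not]; rfl))

theorem exists_interpolant_of_amalgamHom_le (h : S.amalgamHom b a ≤ S.amalgamHom (!b) a') :
    ∃ i ∈ S, a ≤ i ∧ i ≤ a' := by
  have ha : (Function.update ⊤ b a : Bool → H) ∈ S.amalgamLower b a := Entails.of_le (by simp)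
  obtain ⟨i, hi, hai, hia'⟩ := h ha
  exact ⟨i, hi, by simpa using hai, by simpa using hia'⟩

theorem amalgamHom_le_iSup {ι : Sort*} (b : Bool) (f : ι → H)
    (h : ∀ x y t : H, ∃ (n : ι) (c q : H → H), IsQuantifierPair c q ∧ (∀ i ∈ S, c i ∈ S) ∧
      (∀ i ∈ S, q i ∈ S) ∧ c x = x ∧ c y = y ∧ c t = t ∧ a ≤ c (f n)) :
    S.amalgamHom b a ≤ ⨆ n, S.amalgamHom b (f n) := by
  have hle (n : ι) : S.amalgamOf b (f n) ≤ ⨆ n, S.amalgamHom b (f n) :=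
    le_iSup (fun n => S.amalgamHom b (f n)) n
  refine amalgamOf_le_of_forall (fun x y t hf => ?_) fun x y t hf => ?_
  · obtain ⟨n, c, q, hQ, -, hq, hx, hy, ht, hn⟩ := h x y t
    exact ((hf _ (hle n)).quantifier_left hQ hq hx hy ht).mono
      (inf_le_inf_left x hn) le_rfl le_rfl
  · obtain ⟨n, c, q, hQ, hc, -, hx, hy, ht, hn⟩ := h x y t
    exact ((hf _ (hle n)).quantifier_right hQ hc hx hy ht).mono
      le_rfl (inf_le_inf_left x hn) le_rfl

theorem iInf_le_amalgamHom {ι : Sort*} (b : Bool) (f : ι → H)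
    (h : ∀ x y : H, ∃ (n : ι) (c q : H → H), IsQuantifierPair c q ∧
      (∀ i ∈ S, q i ∈ S) ∧ c x = x ∧ c y = y ∧ q (f n) ≤ a) :
    ⨅ n, S.amalgamHom b (f n) ≤ S.amalgamHom b a := by
  intro w hw
  obtain ⟨n, c, q, hQ, hq, hx, hy, hn⟩ := h (w b) (w !b)
  obtain ⟨i, hi, hyi, hin⟩ := iInf_le (fun n => S.amalgamHom b (f n)) n hw
  exact ⟨q i, hq i hi, hQ.le_q _ _ hy hyi, le_trans (hQ.le_q _ _ (hQ.inf _ _ hx (hQ.c_q i))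
    ((inf_le_inf_left _ (hQ.q_le i)).trans hin)) hn⟩

end HeytingSubalgebra

/-! ### Finite transformations -/

section FiniteTransformations

variable {α : Type u} {J J' K : Finset α} {σ τ ν : FinTrans α}

@[simp] theorem finApp_mul (σ τ : FinTrans α) (i : α) :
    finApp (σ * τ) i = finApp σ (finApp τ i) := rfl

theorem finApp_injective : Function.Injective (finApp : FinTrans α → α → α) :=
  Subtype.val_injective

open Classical in
theorem finApp_repl (k l i : α) : finApp (FinTrans.repl k l) i = if i = k then l else i := rfl

theorem repl_mul_repl {k l : α} (m : α) (hkl : k ≠ l) :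
    FinTrans.repl k m * FinTrans.repl k l = FinTrans.repl k l :=
  finApp_injective <| funext fun i => by
    simp only [finApp_mul, finApp_repl]
    by_cases hi : i = k <;> simp [hi, hkl.symm]

open Classical in
/-- The transformation `σ`, changed to `f` on the finite set `J`. -/
noncomputable def modifyOn (σ : FinTrans α) (J : Finset α) (f : α → α) : FinTrans α :=
  ⟨(J.piecewise f (finApp σ) : α → α), by
    refine (J.finite_toSet.union σ.2).subset fun i hi => ?_
    by_cases hiJ : i ∈ J
    · exact Or.inl hiJ
    · exact Or.inr ((Finset.piecewise_eq_of_notMem J f (finApp σ) hiJ).symm.trans_ne hi)⟩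

theorem modifyOn_of_mem (σ : FinTrans α) (f : α → α) {i : α} (hi : i ∈ J) :
    finApp (modifyOn σ J f) i = f i := by
  classical exact Finset.piecewise_eq_of_mem J f (finApp σ) hi

theorem modifyOn_of_notMem (σ : FinTrans α) (f : α → α) {i : α} (hi : i ∉ J) :
    finApp (modifyOn σ J f) i = finApp σ i := by
  classical exact Finset.piecewise_eq_of_notMem J f (finApp σ) hi

open Classical in
theorem finApp_modifyOn_singleton (σ : FinTrans α) (k l i : α) :
    finApp (modifyOn σ {k} fun _ => l) i = if i = k then l else finApp σ i := by
  split_ifs with h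
  · exact modifyOn_of_mem σ _ (Finset.mem_singleton.2 h)
  · exact modifyOn_of_notMem σ _ (mt Finset.mem_singleton.1 h)

theorem modifyOn_singleton_self (σ : FinTrans α) (k : α) :
    (modifyOn σ {k} fun _ => finApp σ k) = σ :=
  finApp_injective <| funext fun i => by
    rw [finApp_modifyOn_singleton]
    split_ifs with h
    exacts [h ▸ rfl, rfl]

/-- `σ` and `τ` agree outside the finite set `J`. -/
def AgreeOff (J : Finset α) (σ τ : FinTrans α) : Prop := ∀ i, i ∉ J → finApp σ i = finApp τ i

theorem AgreeOff.refl (J : Finset α) (σ : FinTrans α) : AgreeOff J σ σ := fun _ _ => rfl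

theorem AgreeOff.symm (h : AgreeOff J σ τ) : AgreeOff J τ σ := fun i hi => (h i hi).symm

theorem AgreeOff.trans (h : AgreeOff J σ τ) (h' : AgreeOff J τ ν) : AgreeOff J σ ν :=
  fun i hi => (h i hi).trans (h' i hi)

theorem AgreeOff.congr_right (h : AgreeOff J σ τ) : AgreeOff J ν σ ↔ AgreeOff J ν τ :=
  ⟨fun h' => h'.trans h, fun h' => h'.trans h.symm⟩

theorem AgreeOff.mul_left (h : AgreeOff J σ τ) (μ : FinTrans α) : AgreeOff J (μ * σ) (μ * τ) :=
  fun i hi => congrArg (finApp μ) (h i hi)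

theorem agreeOff_modifyOn (σ : FinTrans α) (J : Finset α) (f : α → α) :
    AgreeOff J (modifyOn σ J f) σ := fun _ hi => modifyOn_of_notMem σ f hi

theorem exists_agreeOff (σ τ : FinTrans α) : ∃ J, AgreeOff J σ τ := by
  refine ⟨(σ.2.union τ.2).toFinset, fun i hi => ?_⟩
  simp only [Set.Finite.mem_toFinset, Set.mem_union, Set.mem_ofPred_eq, not_or, not_not] at hi
  exact hi.1.trans hi.2.symm

open Classical in
theorem agreeOff_union_iff :
    AgreeOff (J ∪ J') ν σ ↔ ∃ μ, AgreeOff J μ σ ∧ AgreeOff J' ν μ := by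
  constructor
  · intro h
    refine ⟨modifyOn σ J (finApp ν), agreeOff_modifyOn _ _ _, fun i hi => ?_⟩
    by_cases hJ : i ∈ J
    · rw [modifyOn_of_mem σ _ hJ]
    · rw [modifyOn_of_notMem σ _ hJ]
      exact h i (by simp [hJ, hi])
  · rintro ⟨μ, h, h'⟩ i hi
    rw [Finset.mem_union, not_or] at hi
    exact (h' i hi.2).trans (h i hi.1)

theorem agreeOff_preimage_iff {μ : FinTrans α}
    (h : Set.InjOn (finApp σ) (finApp σ ⁻¹' (J : Set α))) :
    AgreeOff (J.preimage (finApp σ) h) ν (μ * σ) ↔ ∃ κ, AgreeOff J κ μ ∧ κ * σ = ν := by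
  constructor
  · intro hν
    let f : α → α :=
      Function.extend ((finApp σ ⁻¹' J).domRestrict (finApp σ)) (fun i => finApp ν i) id
    refine ⟨modifyOn μ J f, agreeOff_modifyOn _ _ _, finApp_injective <| funext fun i => ?_⟩
    rw [finApp_mul]
    by_cases hi : finApp σ i ∈ J
    · rw [modifyOn_of_mem μ _ hi]
      exact h.injective.extend_apply (fun i => finApp ν i) id ⟨i, hi⟩
    · rw [modifyOn_of_notMem μ _ hi]
      exact (hν i (mt Finset.mem_preimage.1 hi)).symm
  · rintro ⟨κ, hκ, rfl⟩ i hi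
    exact hκ _ (mt Finset.mem_preimage.2 hi)

theorem exists_finset_apply_eq_iff (σ : FinTrans α) :
    ∃ V : Finset α, ∀ k ∉ V, ∀ i, finApp σ i = k ↔ i = k := by
  have hσ : {i | finApp σ i ≠ i}.Finite := σ.2
  refine ⟨(hσ.union (hσ.image (finApp σ))).toFinset, fun k hk i => ⟨?_, ?_⟩⟩ <;>
    simp only [Set.Finite.mem_toFinset, Set.mem_union, Set.mem_image, Set.mem_ofPred_eq,
      not_or, not_exists, not_and, not_not] at hk
  · rintro rfl
    by_contra hi
    exact hk.2 i (Ne.symm hi) rfl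
  · rintro rfl
    exact hk.1

/-- `ν` renames each variable in `J` to a fresh one in `K`, and thereby identifies the two. `ν'`
does not, so that the law for `c K (s ν' a)` applies. -/
theorem exists_agreeOff_fresh {P : Set α} (hP : P.Infinite) (J : Finset α) (σ : FinTrans α) :
    ∃ (K : Finset α) (ν ν' : FinTrans α), ↑K ⊆ P ∧ AgreeOff J ν σ ∧ AgreeOff K ν' ν ∧
      Set.InjOn (finApp ν') J ∧ ∀ i, finApp ν' i ∈ K ↔ i ∈ J := by
  classical
  obtain ⟨o, -⟩ := hP.nonempty
  have : Nonempty α := ⟨o⟩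
  obtain ⟨V, hV⟩ := exists_finset_apply_eq_iff σ
  have hfresh := hP.sdiff (insert o (J ∪ V)).finite_toSet
  obtain ⟨g, hg, hinj⟩ := J.finite_toSet.exists_injOn_of_encard_le
    (t := P \ (insert o (J ∪ V) : Finset α)) (hfresh.encard_eq ▸ le_top)
  have hgP (j) (hj : j ∈ J) : g j ∈ P := (hg hj).1
  have hg' (j) (hj : j ∈ J) : g j ≠ o ∧ g j ∉ J ∧ g j ∉ V := by simpa using (hg hj).2
  have hgJ (j) (hj : j ∈ J) :
      finApp (modifyOn (modifyOn σ J g) (J.image g) fun _ => o) j = g j := by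
    have hjK : j ∉ J.image g := fun h => by
      obtain ⟨i, hi, rfl⟩ := Finset.mem_image.1 h
      exact (hg' i hi).2.1 hj
    rw [modifyOn_of_notMem _ _ hjK, modifyOn_of_mem _ _ hj]
  refine ⟨J.image g, modifyOn σ J g, modifyOn (modifyOn σ J g) (J.image g) fun _ => o,
    by simpa [Set.subset_def] using hgP, agreeOff_modifyOn _ _ _, agreeOff_modifyOn _ _ _,
    hinj.congr fun j hj => (hgJ j hj).symm, fun i => ⟨fun hi => ?_, fun hi => ?_⟩⟩
  · by_contra hiJ
    obtain ⟨j, hj, hji⟩ := Finset.mem_image.1 hi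
    by_cases hiK : i ∈ J.image g
    · rw [modifyOn_of_mem _ _ hiK] at hji
      exact (hg' j hj).1 hji
    · rw [modifyOn_of_notMem _ _ hiK, modifyOn_of_notMem _ _ hiJ] at hji
      exact hiK (((hV _ (hg' j hj).2.2 i).1 hji.symm) ▸ Finset.mem_image_of_mem g hj)
  · rw [hgJ i hi]
    exact Finset.mem_image_of_mem g hi

end FiniteTransformations

/-! ### Functional polyadic algebras -/

section FunctionalQuantifiers

variable {α : Type u} {C : Type*}

section CompleteLattice

variable [CompleteLattice C]

/-- The cylindrification by suprema of a function of a finite transformation. -/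
def cyl (J : Finset α) (F : FinTrans α → C) (σ : FinTrans α) : C :=
  ⨆ ν, ⨆ (_ : AgreeOff J ν σ), F ν

/-- The cylindrification by infima of a function of a finite transformation. Its basic properties
are those of `cyl` in the dual lattice. -/
def cocyl (J : Finset α) (F : FinTrans α → C) (σ : FinTrans α) : C :=
  ⨅ ν, ⨅ (_ : AgreeOff J ν σ), F ν

variable {J J' : Finset α} {F : FinTrans α → C} {σ ν : FinTrans α}

theorem le_cyl_of_agreeOff (h : AgreeOff J ν σ) : F ν ≤ cyl J F σ := le_iSup₂_of_le ν h le_rfl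

theorem cocyl_le_of_agreeOff (h : AgreeOff J ν σ) : cocyl J F σ ≤ F ν := iInf₂_le_of_le ν h le_rfl

theorem le_cyl (J : Finset α) (F : FinTrans α → C) : F ≤ cyl J F :=
  fun σ => le_cyl_of_agreeOff (.refl J σ)

theorem cocyl_le (J : Finset α) (F : FinTrans α → C) : cocyl J F ≤ F :=
  fun σ => cocyl_le_of_agreeOff (.refl J σ)

theorem AgreeOff.cyl_eq (h : AgreeOff J ν σ) (F : FinTrans α → C) : cyl J F ν = cyl J F σ := by
  simp only [cyl, h.congr_right]

theorem AgreeOff.cocyl_eq (h : AgreeOff J ν σ) (F : FinTrans α → C) :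
    cocyl J F ν = cocyl J F σ :=
  h.cyl_eq (C := Cᵒᵈ) F

theorem cyl_eq_self (hF : ∀ ν σ, AgreeOff J ν σ → F ν = F σ) : cyl J F = F :=
  le_antisymm (fun σ => iSup₂_le fun ν hν => (hF ν σ hν).le) (le_cyl J F)

theorem cocyl_eq_self (hF : ∀ ν σ, AgreeOff J ν σ → F ν = F σ) : cocyl J F = F :=
  cyl_eq_self (C := Cᵒᵈ) hF

open Classical in
theorem cyl_union (J J' : Finset α) (F : FinTrans α → C) :
    cyl (J ∪ J') F = cyl J (cyl J' F) := funext fun σ => by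
  simp only [cyl, agreeOff_union_iff, iSup_exists, iSup_and]
  rw [iSup_comm]
  exact iSup_congr fun μ => iSup_comm

open Classical in
theorem cocyl_union (J J' : Finset α) (F : FinTrans α → C) :
    cocyl (J ∪ J') F = cocyl J (cocyl J' F) :=
  cyl_union (C := Cᵒᵈ) J J' F

theorem cyl_mul_right (h : Set.InjOn (finApp σ) (finApp σ ⁻¹' (J : Set α)))
    (F : FinTrans α → C) (μ : FinTrans α) :
    cyl (J.preimage (finApp σ) h) F (μ * σ) = cyl J (fun κ => F (κ * σ)) μ := by
  simp only [cyl, agreeOff_preimage_iff h, iSup_exists, iSup_and]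
  rw [iSup_comm]
  refine iSup_congr fun κ => ?_
  rw [iSup_comm]
  simp only [iSup_iSup_eq_right]

theorem cocyl_mul_right (h : Set.InjOn (finApp σ) (finApp σ ⁻¹' (J : Set α)))
    (F : FinTrans α → C) (μ : FinTrans α) :
    cocyl (J.preimage (finApp σ) h) F (μ * σ) = cocyl J (fun κ => F (κ * σ)) μ :=
  cyl_mul_right (C := Cᵒᵈ) h F μ

end CompleteLattice

variable [Order.Frame C] {J : Finset α}

theorem cyl_inf_cyl (J : Finset α) (F G : FinTrans α → C) :
    cyl J (F ⊓ cyl J G) = cyl J F ⊓ cyl J G := funext fun σ => by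
  change ⨆ ν, ⨆ (_ : AgreeOff J ν σ), F ν ⊓ cyl J G ν =
    (⨆ ν, ⨆ (_ : AgreeOff J ν σ), F ν) ⊓ cyl J G σ
  rw [iSup₂_inf_eq]
  exact iSup_congr fun ν => iSup_congr fun hν => by rw [hν.cyl_eq]

theorem cocyl_himp_le (J : Finset α) (F G : FinTrans α → C) :
    cocyl J (F ⇨ G) ≤ cocyl J F ⇨ cocyl J G := fun _ =>
  le_himp_iff.2 <| le_iInf₂ fun _ hν =>
    le_himp_iff.1 <| (cocyl_le_of_agreeOff hν).trans <| himp_le_himp_right <|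
      cocyl_le_of_agreeOff hν

end FunctionalQuantifiers

/-- A family of `C`-valued equality relations on `α` (none if `e = false`). -/
structure ValuedEquality (e : Bool) (α : Type u) (C : Type*) [Order.Frame C] where
  val : e = true → α → α → C
  refl : ∀ he k, val he k k = ⊤
  symm : ∀ he k l, val he k l ≤ val he l k
  trans : ∀ he k l m, val he k l ⊓ val he l m ≤ val he k m

namespace ValuedEquality

variable {e : Bool} {α : Type u} {C : Type*} [Order.Frame C]

section

variable (D : ValuedEquality e α C) (he : e = true)

/-- The value of the statement that two finite transformations are equal. -/
def agree (σ σ' : FinTrans α) : C := ⨅ i, D.val he (finApp σ i) (finApp σ' i)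

theorem agree_comm (σ σ' : FinTrans α) : D.agree he σ σ' = D.agree he σ' σ :=
  le_antisymm (iInf_mono fun _ => D.symm he _ _) (iInf_mono fun _ => D.symm he _ _)

theorem agree_le_agree_mul_right (σ σ' τ : FinTrans α) :
    D.agree he σ σ' ≤ D.agree he (σ * τ) (σ' * τ) :=
  le_iInf fun i => iInf_le _ (finApp τ i)

theorem agree_le_agree_modifyOn {J : Finset α} {ν σ : FinTrans α} (hν : AgreeOff J ν σ)
    (σ' : FinTrans α) : D.agree he σ σ' ≤ D.agree he ν (modifyOn σ' J (finApp ν)) := by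
  refine iInf_mono fun i => ?_
  by_cases hi : i ∈ J
  · rw [modifyOn_of_mem _ _ hi, D.refl]
    exact le_top
  · rw [modifyOn_of_notMem _ _ hi, hν i hi]

theorem le_agree_mul_repl (σ : FinTrans α) (k l : α) :
    D.val he (finApp σ k) (finApp σ l) ≤ D.agree he σ (σ * FinTrans.repl k l) := by
  refine le_iInf fun i => ?_
  rw [finApp_mul, finApp_repl]
  split_ifs with hik
  · rw [hik]
  · rw [D.refl]
    exact le_top

end

variable {D : ValuedEquality e α C}

variable (D) in
/-- `F` respects the equality `D`: arguments that are equal to some degree have values that are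
equal to at least that degree. -/
def IsExtensional (F : FinTrans α → C) : Prop :=
  ∀ he σ σ', F σ ⊓ D.agree he σ σ' ≤ F σ'

namespace IsExtensional

variable {F G : FinTrans α → C}

theorem sup (hF : D.IsExtensional F) (hG : D.IsExtensional G) : D.IsExtensional (F ⊔ G) :=
  fun he σ σ' => by
    rw [Pi.sup_apply, inf_sup_right]
    exact sup_le_sup (hF he σ σ') (hG he σ σ')

theorem inf (hF : D.IsExtensional F) (hG : D.IsExtensional G) : D.IsExtensional (F ⊓ G) :=
  fun he σ σ' => le_inf ((inf_le_inf_right _ inf_le_left).trans (hF he σ σ'))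
    ((inf_le_inf_right _ inf_le_right).trans (hG he σ σ'))

theorem himp (hF : D.IsExtensional F) (hG : D.IsExtensional G) : D.IsExtensional (F ⇨ G) :=
  fun he σ σ' => by
    rw [Pi.himp_apply, Pi.himp_apply, le_himp_iff]
    have hFσ : F σ' ⊓ D.agree he σ σ' ≤ F σ := by
      rw [D.agree_comm]
      exact hF he σ' σ
    calc (F σ ⇨ G σ) ⊓ D.agree he σ σ' ⊓ F σ'
        = (F σ ⇨ G σ) ⊓ (F σ' ⊓ D.agree he σ σ') ⊓ D.agree he σ σ' := by
          rw [inf_assoc, inf_assoc, inf_assoc, inf_idem, inf_comm (F σ')]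
      _ ≤ (F σ ⇨ G σ) ⊓ F σ ⊓ D.agree he σ σ' :=
          inf_le_inf_right _ (inf_le_inf_left _ hFσ)
      _ ≤ G σ ⊓ D.agree he σ σ' := inf_le_inf_right _ himp_inf_le
      _ ≤ G σ' := hG he σ σ'

theorem bot : D.IsExtensional (⊥ : FinTrans α → C) := fun _ _ _ => inf_le_left

theorem translate (hF : D.IsExtensional F) (τ : FinTrans α) :
    D.IsExtensional fun σ => F (σ * τ) := fun he σ σ' =>
  (inf_le_inf_left _ (D.agree_le_agree_mul_right he σ σ' τ)).trans (hF he (σ * τ) (σ' * τ))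

theorem cyl (hF : D.IsExtensional F) (J : Finset α) : D.IsExtensional (cyl J F) :=
  fun he σ σ' => by
    rw [_root_.cyl, iSup₂_inf_eq]
    exact iSup₂_le fun ν hν => (inf_le_inf_left _ (D.agree_le_agree_modifyOn he hν σ')).trans <|
      (hF he _ _).trans (le_cyl_of_agreeOff (agreeOff_modifyOn _ _ _))

theorem cocyl (hF : D.IsExtensional F) (J : Finset α) : D.IsExtensional (cocyl J F) :=
  fun he σ σ' => le_iInf₂ fun ν hν => by
    refine (inf_le_inf (cocyl_le_of_agreeOff (agreeOff_modifyOn σ J (finApp ν))) ?_).trans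
      (hF he _ ν)
    rw [D.agree_comm he σ, D.agree_comm he _ ν]
    exact D.agree_le_agree_modifyOn he hν σ

theorem diag (he : e = true) (k l : α) :
    D.IsExtensional fun σ => D.val he (finApp σ k) (finApp σ l) := fun _ σ σ' =>
  calc D.val he (finApp σ k) (finApp σ l) ⊓ D.agree he σ σ'
      ≤ D.val he (finApp σ' k) (finApp σ k) ⊓
          (D.val he (finApp σ k) (finApp σ l) ⊓ D.val he (finApp σ l) (finApp σ' l)) :=
        le_inf (inf_le_right.trans ((iInf_le _ k).trans (D.symm he _ _)))
          (inf_le_inf_left _ (iInf_le _ l))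
    _ ≤ D.val he (finApp σ' k) (finApp σ k) ⊓ D.val he (finApp σ k) (finApp σ' l) :=
        inf_le_inf_left _ (D.trans he _ _ _)
    _ ≤ D.val he (finApp σ' k) (finApp σ' l) := D.trans he _ _ _

theorem of_modifyOn_singleton
    (hF : ∀ he σ k l, F σ ⊓ D.val he (finApp σ k) l ≤ F (modifyOn σ {k} fun _ => l)) :
    D.IsExtensional F := fun he σ σ' => by
  classical
  obtain ⟨J, hJ⟩ := exists_agreeOff σ σ'
  induction J using Finset.induction_on generalizing σ with
  | empty =>
    rw [finApp_injective (funext fun i => hJ i (Finset.notMem_empty i))]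
    exact inf_le_left
  | insert k J _ ih =>
    refine le_trans (le_inf ?_ ?_) (ih (modifyOn σ {k} fun _ => finApp σ' k) fun i hi => ?_)
    · exact (inf_le_inf_left _ (iInf_le _ k)).trans (hF he σ k _)
    · refine inf_le_right.trans (iInf_mono fun i => ?_)
      rw [finApp_modifyOn_singleton]
      split_ifs with hik
      · rw [hik, D.refl]
        exact le_top
      · exact le_rfl
    · rw [finApp_modifyOn_singleton]
      split_ifs with hik
      · rw [hik]
      · exact hJ i (by simp [hik, hi])

end IsExtensional

variable (D)

/-- The polyadic algebra of the extensional functions of a finite transformation: substitutions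
act by translation, quantifiers are suprema and infima, and the diagonal constants are given
by `D`. -/
def extensionalAlg : PolyAlg e α {F : FinTrans α → C // D.IsExtensional F} where
  join F G := ⟨F.1 ⊔ G.1, F.2.sup G.2⟩
  meet F G := ⟨F.1 ⊓ G.1, F.2.inf G.2⟩
  imp F G := ⟨F.1 ⇨ G.1, F.2.himp G.2⟩
  zero := ⟨⊥, .bot⟩
  s τ F := ⟨fun σ => F.1 (σ * τ), F.2.translate τ⟩
  c J F := ⟨cyl J F.1, F.2.cyl J⟩
  q J F := ⟨cocyl J F.1, F.2.cocyl J⟩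
  d he k l := ⟨fun σ => D.val he (finApp σ k) (finApp σ l), .diag he k l⟩

variable {D}

theorem extensionalAlg_le_iff {F G : {F : FinTrans α → C // D.IsExtensional F}} :
    D.extensionalAlg.le F G ↔ F.1 ≤ G.1 :=
  Subtype.ext_iff.trans inf_eq_left

theorem coe_extensionalAlg_one : (D.extensionalAlg.one).1 = ⊤ := himp_self

end ValuedEquality

namespace PolyAlg

variable {e : Bool} {α : Type u} {A B : Type*}

/-- `f` is a homomorphism of algebras of the similarity type of polyadic Heyting algebras. -/
structure IsHom (𝔄 : PolyAlg e α A) (𝔅 : PolyAlg e α B) (f : A → B) : Prop where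
  join : ∀ a b, f (𝔄.join a b) = 𝔅.join (f a) (f b)
  meet : ∀ a b, f (𝔄.meet a b) = 𝔅.meet (f a) (f b)
  imp : ∀ a b, f (𝔄.imp a b) = 𝔅.imp (f a) (f b)
  zero : f 𝔄.zero = 𝔅.zero
  s : ∀ τ a, f (𝔄.s τ a) = 𝔅.s τ (f a)
  c : ∀ J a, f (𝔄.c J a) = 𝔅.c J (f a)
  q : ∀ J a, f (𝔄.q J a) = 𝔅.q J (f a)
  d : ∀ he k l, f (𝔄.d he k l) = 𝔅.d he k l

namespace IsHom

variable {𝔄 : PolyAlg e α A} {𝔅 : PolyAlg e α B} {f g : A → B}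

theorem one (hf : 𝔄.IsHom 𝔅 f) : f 𝔄.one = 𝔅.one := by
  rw [PolyAlg.one, hf.imp, hf.zero, PolyAlg.one]

theorem le (hf : 𝔄.IsHom 𝔅 f) {a b : A} (hab : 𝔄.le a b) : 𝔅.le (f a) (f b) :=
  (hf.meet a b).symm.trans (congrArg f hab)

theorem eqOn_sg (hf : 𝔄.IsHom 𝔅 f) (hg : 𝔄.IsHom 𝔅 g) {X : Set A} (hfg : Set.EqOn f g X) :
    Set.EqOn f g (𝔄.Sg X) := fun a ha => by
  induction ha with
  | of a ha => exact hfg ha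
  | join a b _ _ iha ihb => rw [hf.join, hg.join, iha, ihb]
  | meet a b _ _ iha ihb => rw [hf.meet, hg.meet, iha, ihb]
  | imp a b _ _ iha ihb => rw [hf.imp, hg.imp, iha, ihb]
  | zero => rw [hf.zero, hg.zero]
  | s τ a _ ih => rw [hf.s, hg.s, ih]
  | c J a _ ih => rw [hf.c, hg.c, ih]
  | q J a _ ih => rw [hf.q, hg.q, ih]
  | d he i j => rw [hf.d, hg.d]

theorem isCon_ker (hf : 𝔄.IsHom 𝔅 f) : 𝔄.IsCon (Setoid.ker f) where
  join a a' b b' (ha : f a = f a') (hb : f b = f b') := by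
    rw [Setoid.ker_def, hf.join, hf.join, ha, hb]
  meet a a' b b' (ha : f a = f a') (hb : f b = f b') := by
    rw [Setoid.ker_def, hf.meet, hf.meet, ha, hb]
  imp a a' b b' (ha : f a = f a') (hb : f b = f b') := by
    rw [Setoid.ker_def, hf.imp, hf.imp, ha, hb]
  s τ a a' (ha : f a = f a') := by rw [Setoid.ker_def, hf.s, hf.s, ha]
  c J a a' (ha : f a = f a') := by rw [Setoid.ker_def, hf.c, hf.c, ha]
  q J a a' (ha : f a = f a') := by rw [Setoid.ker_def, hf.q, hf.q, ha]

theorem quotientLift (hf : 𝔄.IsHom 𝔅 f) {R : Setoid A} (h : 𝔄.IsCon R)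
    (hR : ∀ a b, R a b → f a = f b) : (𝔄.quot R h).IsHom 𝔅 (Quotient.lift f hR) where
  join := by rintro ⟨a⟩ ⟨b⟩; exact hf.join a b
  meet := by rintro ⟨a⟩ ⟨b⟩; exact hf.meet a b
  imp := by rintro ⟨a⟩ ⟨b⟩; exact hf.imp a b
  zero := hf.zero
  s := by rintro τ ⟨a⟩; exact hf.s τ a
  c := by rintro J ⟨a⟩; exact hf.c J a
  q := by rintro J ⟨a⟩; exact hf.q J a
  d := hf.d

end IsHom

theorem isHom_quotientMk (𝔄 : PolyAlg e α A) {R : Setoid A} (h : 𝔄.IsCon R) :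
    𝔄.IsHom (𝔄.quot R h) (Quotient.mk R) where
  join _ _ := rfl
  meet _ _ := rfl
  imp _ _ := rfl
  zero := rfl
  s _ _ := rfl
  c _ _ := rfl
  q _ _ := rfl
  d _ _ _ := rfl

theorem isHeyting_of_injective [HeytingAlgebra B] (𝔄 : PolyAlg e α A) (f : A → B)
    (hf : Function.Injective f) (join : ∀ a b, f (𝔄.join a b) = f a ⊔ f b)
    (meet : ∀ a b, f (𝔄.meet a b) = f a ⊓ f b) (imp : ∀ a b, f (𝔄.imp a b) = f a ⇨ f b)
    (zero : f 𝔄.zero = ⊥) : 𝔄.IsHeyting := by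
  let _ : Max A := ⟨𝔄.join⟩
  let _ : Min A := ⟨𝔄.meet⟩
  let _ : LE A := ⟨fun a b => f a ≤ f b⟩
  let _ : LT A := ⟨fun a b => f a < f b⟩
  let _ : Top A := ⟨𝔄.imp 𝔄.zero 𝔄.zero⟩
  let _ : Bot A := ⟨𝔄.zero⟩
  let _ : Compl A := ⟨fun a => 𝔄.imp a 𝔄.zero⟩
  let _ : HImp A := ⟨𝔄.imp⟩
  exact ⟨hf.heytingAlgebra f Iff.rfl Iff.rfl join meet ((imp _ _).trans himp_self) zero
    (fun a => (imp _ _).trans (by rw [zero, himp_bot])) imp, fun _ _ => rfl, fun _ _ => rfl,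
    fun _ _ => rfl, rfl⟩

section JointlyInjective

variable {ι : Type*} {B : ι → Type*} {𝔄 : PolyAlg e α A} {𝔅 : ∀ i, PolyAlg e α (B i)}
  {f : ∀ i, A → B i}

theorem le_of_forall_le (hf : ∀ i, 𝔄.IsHom (𝔅 i) (f i))
    (hinj : ∀ a b, (∀ i, f i a = f i b) → a = b) {a b : A}
    (hab : ∀ i, (𝔅 i).le (f i a) (f i b)) : 𝔄.le a b :=
  hinj _ _ fun i => ((hf i).meet a b).trans (hab i)

theorem isHeyting_of_jointly_injective (hf : ∀ i, 𝔄.IsHom (𝔅 i) (f i))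
    (hinj : ∀ a b, (∀ i, f i a = f i b) → a = b) (h : ∀ i, (𝔅 i).IsHeyting) :
    𝔄.IsHeyting := by
  choose _ join meet imp zero using h
  exact 𝔄.isHeyting_of_injective (fun a i => f i a) (fun a b hab => hinj a b (congrFun hab))
    (fun a b => funext fun i => ((hf i).join a b).trans (join i _ _))
    (fun a b => funext fun i => ((hf i).meet a b).trans (meet i _ _))
    (fun a b => funext fun i => ((hf i).imp a b).trans (imp i _ _))
    (funext fun i => (hf i).zero.trans (zero i))

theorem isHeytingEnd_of_jointly_injective (hf : ∀ i, 𝔄.IsHom (𝔅 i) (f i))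
    (hinj : ∀ a b, (∀ i, f i a = f i b) → a = b) {g : A → A} {g' : ∀ i, B i → B i}
    (hg : ∀ i a, f i (g a) = g' i (f i a)) (h : ∀ i, (𝔅 i).IsHeytingEnd (g' i)) :
    𝔄.IsHeytingEnd g where
  join p r := hinj _ _ fun i => by simp only [hg, (hf i).join, (h i).join]
  meet p r := hinj _ _ fun i => by simp only [hg, (hf i).meet, (h i).meet]
  imp p r := hinj _ _ fun i => by simp only [hg, (hf i).imp, (h i).imp]
  zero := hinj _ _ fun i => by simp only [hg, (hf i).zero, (h i).zero]

theorem isExistential_of_jointly_injective (hf : ∀ i, 𝔄.IsHom (𝔅 i) (f i))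
    (hinj : ∀ a b, (∀ i, f i a = f i b) → a = b) {E : A → A} {E' : ∀ i, B i → B i}
    (hE : ∀ i a, f i (E a) = E' i (f i a)) (h : ∀ i, (𝔅 i).IsExistential (E' i)) :
    𝔄.IsExistential E where
  zero := hinj _ _ fun i => by simp only [hE, (hf i).zero, (h i).zero]
  le p := le_of_forall_le hf hinj fun i => by simpa only [hE] using (h i).le (f i p)
  meet p r := hinj _ _ fun i => by simp only [hE, (hf i).meet, (h i).meet]
  imp p r := hinj _ _ fun i => by simp only [hE, (hf i).imp, (h i).imp]
  join p r := hinj _ _ fun i => by simp only [hE, (hf i).join, (h i).join]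
  idem p := hinj _ _ fun i => by simp only [hE, (h i).idem]

theorem isUniversal_of_jointly_injective (hf : ∀ i, 𝔄.IsHom (𝔅 i) (f i))
    (hinj : ∀ a b, (∀ i, f i a = f i b) → a = b) {U : A → A} {U' : ∀ i, B i → B i}
    (hU : ∀ i a, f i (U a) = U' i (f i a)) (h : ∀ i, (𝔅 i).IsUniversal (U' i)) :
    𝔄.IsUniversal U where
  one := hinj _ _ fun i => by simp only [hU, (hf i).one, (h i).one]
  le p := le_of_forall_le hf hinj fun i => by simpa only [hU] using (h i).le (f i p)
  imp p r := le_of_forall_le hf hinj fun i => by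
    simpa only [hU, (hf i).imp] using (h i).imp (f i p) (f i r)
  idem p := hinj _ _ fun i => by simp only [hU, (h i).idem]

theorem isGPHA_of_jointly_injective (hf : ∀ i, 𝔄.IsHom (𝔅 i) (f i))
    (hinj : ∀ a b, (∀ i, f i a = f i b) → a = b) (h : ∀ i, (𝔅 i).IsGPHA) : 𝔄.IsGPHA where
  heyting := isHeyting_of_jointly_injective hf hinj fun i => (h i).heyting
  s_end τ := isHeytingEnd_of_jointly_injective hf hinj (fun i => (hf i).s τ) fun i => (h i).s_end τ
  c_ex J := isExistential_of_jointly_injective hf hinj (fun i => (hf i).c J) fun i => (h i).c_ex J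
  q_univ J := isUniversal_of_jointly_injective hf hinj (fun i => (hf i).q J) fun i => (h i).q_univ J
  s_one p := hinj _ _ fun i => by rw [(hf i).s, (h i).s_one]
  s_mul σ τ p := hinj _ _ fun i => by simp only [(hf i).s, (h i).s_mul]
  c_union J J' p := hinj _ _ fun i => by simp only [(hf i).c, (h i).c_union]
  q_union J J' p := hinj _ _ fun i => by simp only [(hf i).q, (h i).q_union]
  c_q J p := hinj _ _ fun i => by simp only [(hf i).c, (hf i).q, (h i).c_q]
  q_c J p := hinj _ _ fun i => by simp only [(hf i).c, (hf i).q, (h i).q_c]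
  s_c σ τ J p hστ := hinj _ _ fun i => by
    simpa only [(hf i).s, (hf i).c] using (h i).s_c σ τ J _ hστ
  s_q σ τ J p hστ := hinj _ _ fun i => by
    simpa only [(hf i).s, (hf i).q] using (h i).s_q σ τ J _ hστ
  c_s σ J p hσ := hinj _ _ fun i => by simp only [(hf i).s, (hf i).c, (h i).c_s σ J _ hσ]
  q_s σ J p hσ := hinj _ _ fun i => by simp only [(hf i).s, (hf i).q, (h i).q_s σ J _ hσ]
  d_refl he k := hinj _ _ fun i => by rw [(hf i).d, (hf i).one, (h i).d_refl]
  s_d he τ k l := hinj _ _ fun i => by simp only [(hf i).s, (hf i).d, (h i).s_d]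
  d_le he k l p := le_of_forall_le hf hinj fun i => by
    simpa only [(hf i).meet, (hf i).d, (hf i).s] using (h i).d_le he k l (f i p)

end JointlyInjective

theorem IsHom.isGPHA_quot_ker {𝔄 : PolyAlg e α A} {𝔅 : PolyAlg e α B} {f : A → B}
    (hf : 𝔄.IsHom 𝔅 f) (h : 𝔅.IsGPHA) : (𝔄.quot (Setoid.ker f) hf.isCon_ker).IsGPHA :=
  isGPHA_of_jointly_injective (ι := Unit)
    (fun _ => hf.quotientLift hf.isCon_ker fun _ _ hab => hab)
    (by rintro ⟨a⟩ ⟨b⟩ hab; exact Quotient.sound (hab ())) fun _ => h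

end PolyAlg

theorem ValuedEquality.isGPHA_extensionalAlg {e : Bool} {α : Type u} {C : Type*} [Order.Frame C]
    (D : ValuedEquality e α C) : D.extensionalAlg.IsGPHA where
  heyting := D.extensionalAlg.isHeyting_of_injective Subtype.val Subtype.val_injective
    (fun _ _ => rfl) (fun _ _ => rfl) (fun _ _ => rfl) rfl
  s_end τ := ⟨fun _ _ => rfl, fun _ _ => rfl, fun _ _ => rfl, rfl⟩
  c_ex J :=
    { zero := Subtype.ext (cyl_eq_self fun _ _ _ => rfl)
      le p := extensionalAlg_le_iff.2 (le_cyl J p.1)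
      meet p r := Subtype.ext (cyl_inf_cyl J p.1 r.1)
      imp p r := Subtype.ext <| cyl_eq_self fun ν σ h =>
        congrArg₂ (· ⇨ ·) (h.cyl_eq p.1) (h.cyl_eq r.1)
      join p r := Subtype.ext <| cyl_eq_self fun ν σ h =>
        congrArg₂ (· ⊔ ·) (h.cyl_eq p.1) (h.cyl_eq r.1)
      idem p := Subtype.ext <| cyl_eq_self fun ν σ h => h.cyl_eq p.1 }
  q_univ J :=
    { one := Subtype.ext <| cocyl_eq_self fun ν σ _ => by rw [coe_extensionalAlg_one]; rfl
      le p := extensionalAlg_le_iff.2 (cocyl_le J p.1)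
      imp p r := extensionalAlg_le_iff.2 (cocyl_himp_le J p.1 r.1)
      idem p := Subtype.ext <| cocyl_eq_self fun ν σ h => h.cocyl_eq p.1 }
  s_one p := rfl
  s_mul σ τ p := rfl
  c_union J J' p := Subtype.ext (cyl_union J J' p.1)
  q_union J J' p := Subtype.ext (cocyl_union J J' p.1)
  c_q J p := Subtype.ext <| cyl_eq_self fun ν σ h => h.cocyl_eq p.1
  q_c J p := Subtype.ext <| cocyl_eq_self fun ν σ h => h.cyl_eq p.1
  s_c σ τ J p h := Subtype.ext <| funext fun μ => (AgreeOff.mul_left h μ).cyl_eq p.1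
  s_q σ τ J p h := Subtype.ext <| funext fun μ => (AgreeOff.mul_left h μ).cocyl_eq p.1
  c_s σ J p hσ := Subtype.ext <| funext fun μ => (cyl_mul_right hσ p.1 μ).symm
  q_s σ J p hσ := Subtype.ext <| funext fun μ => (cocyl_mul_right hσ p.1 μ).symm
  d_refl he k := Subtype.ext <| funext fun σ =>
    (D.refl he _).trans (congrFun coe_extensionalAlg_one σ).symm
  s_d he τ k l := rfl
  d_le he k l p := extensionalAlg_le_iff.2 fun σ =>
    (inf_le_inf_left _ (D.le_agree_mul_repl he σ k l)).trans (p.2 he _ _)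

/-! ### Dimension complemented algebras -/

namespace PolyAlg

variable {e : Bool} {α : Type u} {A : Type*} {𝔄 : PolyAlg e α A}

namespace IsGPHA

variable {J K : Finset α} {σ τ : FinTrans α} {a : A}

theorem q_eq_of_c_eq (h : 𝔄.IsGPHA) (ha : 𝔄.c J a = a) : 𝔄.q J a = a := by
  rw [← ha, h.q_c, ha]

theorem c_eq_of_q_eq (h : 𝔄.IsGPHA) (ha : 𝔄.q J a = a) : 𝔄.c J a = a := by
  rw [← ha, h.c_q, ha]

/-- The laws do not make `c ∅` the identity. -/
theorem c_empty_eq_of_c_eq (h : 𝔄.IsGPHA) (ha : 𝔄.c J a = a) : 𝔄.c ∅ a = a := by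
  classical
  calc 𝔄.c ∅ a = 𝔄.c (∅ ∪ J) a := by rw [h.c_union, ha]
    _ = a := by rw [Finset.empty_union, ha]

theorem c_eq_of_forall_mem (h : 𝔄.IsGPHA) (h₀ : 𝔄.c ∅ a = a)
    (hK : ∀ k ∈ K, 𝔄.c {k} a = a) : 𝔄.c K a = a := by
  classical
  induction K using Finset.induction_on with
  | empty => exact h₀
  | insert k K _ ih =>
    rw [Finset.insert_eq, h.c_union, ih fun i hi => hK i (Finset.mem_insert_of_mem hi)]
    exact hK k (Finset.mem_insert_self _ _)

theorem c_comm (h : 𝔄.IsGPHA) (J K : Finset α) (a : A) :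
    𝔄.c J (𝔄.c K a) = 𝔄.c K (𝔄.c J a) := by
  classical
  rw [← h.c_union, ← h.c_union, Finset.union_comm]

theorem q_comm (h : 𝔄.IsGPHA) (J K : Finset α) (a : A) :
    𝔄.q J (𝔄.q K a) = 𝔄.q K (𝔄.q J a) := by
  classical
  rw [← h.q_union, ← h.q_union, Finset.union_comm]

theorem s_eq_of_agreeOff (h : 𝔄.IsGPHA) (ha : 𝔄.c J a = a) (hστ : AgreeOff J σ τ) :
    𝔄.s σ a = 𝔄.s τ a := by
  rw [← ha]
  exact h.s_c σ τ J a hστ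

theorem c_s_eq (h : 𝔄.IsGPHA) (a : A) (hinj : Set.InjOn (finApp σ) K)
    (hK : ∀ i, finApp σ i ∈ J ↔ i ∈ K) : 𝔄.c J (𝔄.s σ a) = 𝔄.s σ (𝔄.c K a) := by
  have hpre : finApp σ ⁻¹' (J : Set α) = K := Set.ext hK
  rw [h.c_s σ J a (hpre ▸ hinj), (Finset.ext fun i => Finset.mem_preimage.trans (hK i) :
    J.preimage (finApp σ) (hpre ▸ hinj) = K)]

theorem q_s_eq (h : 𝔄.IsGPHA) (a : A) (hinj : Set.InjOn (finApp σ) K)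
    (hK : ∀ i, finApp σ i ∈ J ↔ i ∈ K) : 𝔄.q J (𝔄.s σ a) = 𝔄.s σ (𝔄.q K a) := by
  have hpre : finApp σ ⁻¹' (J : Set α) = K := Set.ext hK
  rw [h.q_s σ J a (hpre ▸ hinj), (Finset.ext fun i => Finset.mem_preimage.trans (hK i) :
    J.preimage (finApp σ) (hpre ▸ hinj) = K)]

end IsGPHA

/-- The laws of polyadic Heyting algebras, for an algebra whose lattice operations are those of a
given Heyting algebra on its carrier. -/
structure IsLatticeGPHA [HeytingAlgebra A] (𝔄 : PolyAlg e α A) : Prop extends 𝔄.IsGPHA where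
  join_eq : ∀ a b, 𝔄.join a b = a ⊔ b
  meet_eq : ∀ a b, 𝔄.meet a b = a ⊓ b
  imp_eq : ∀ a b, 𝔄.imp a b = a ⇨ b
  zero_eq : 𝔄.zero = ⊥

theorem IsGPHA.exists_isLatticeGPHA (h : 𝔄.IsGPHA) :
    ∃ _ : HeytingAlgebra A, 𝔄.IsLatticeGPHA := by
  obtain ⟨inst, join_eq, meet_eq, imp_eq, zero_eq⟩ := h.heyting
  exact ⟨inst, { h with join_eq, meet_eq, imp_eq, zero_eq }⟩

namespace IsLatticeGPHA

variable [HeytingAlgebra A] {a b : A}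

theorem le_iff (h : 𝔄.IsLatticeGPHA) : 𝔄.le a b ↔ a ≤ b := by
  rw [PolyAlg.le, h.meet_eq, inf_eq_left]

theorem one_eq (h : 𝔄.IsLatticeGPHA) : 𝔄.one = ⊤ := by
  rw [PolyAlg.one, h.imp_eq, himp_self]

theorem s_inf (h : 𝔄.IsLatticeGPHA) (τ : FinTrans α) (a b : A) :
    𝔄.s τ (a ⊓ b) = 𝔄.s τ a ⊓ 𝔄.s τ b := by
  rw [← h.meet_eq, ← h.meet_eq, (h.s_end τ).meet]

theorem s_mono (h : 𝔄.IsLatticeGPHA) (τ : FinTrans α) (hab : a ≤ b) : 𝔄.s τ a ≤ 𝔄.s τ b := by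
  rw [← inf_eq_left, ← h.s_inf, inf_eq_left.2 hab]

theorem q_mono (h : 𝔄.IsLatticeGPHA) (J : Finset α) (hab : a ≤ b) : 𝔄.q J a ≤ 𝔄.q J b := by
  have := h.le_iff.1 ((h.q_univ J).imp a b)
  rwa [h.imp_eq, h.imp_eq, himp_eq_top_iff.2 hab, ← h.one_eq, (h.q_univ J).one, h.one_eq,
    top_le_iff, himp_eq_top_iff] at this

theorem isQuantifierPair (h : 𝔄.IsLatticeGPHA) (J : Finset α) :
    IsQuantifierPair (𝔄.c J) (𝔄.q J) where
  le_c a := h.le_iff.1 ((h.c_ex J).le a)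
  c_le a t ht hat := by
    have := (h.c_ex J).meet a t
    rw [h.meet_eq, h.meet_eq, ht, inf_eq_left.2 hat] at this
    rw [this]
    exact inf_le_right
  c_c := (h.c_ex J).idem
  q_le a := h.le_iff.1 ((h.q_univ J).le a)
  le_q a t ht hta := by
    rw [← h.q_eq_of_c_eq ht]
    exact h.q_mono J hta
  c_q := h.c_q J
  inf a b ha hb := by
    have := (h.c_ex J).meet a b
    rwa [hb, ha, h.meet_eq] at this
  himp a b ha hb := by
    have := (h.c_ex J).imp a b
    rwa [hb, ha, h.imp_eq] at this

section Diagonals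

theorem d_self (h : 𝔄.IsLatticeGPHA) (he : e = true) (k : α) : 𝔄.d he k k = ⊤ := by
  rw [h.d_refl, h.one_eq]

theorem inf_d_le (h : 𝔄.IsLatticeGPHA) (he : e = true) (k l : α) (p : A) :
    p ⊓ 𝔄.d he k l ≤ 𝔄.s (FinTrans.repl k l) p := by
  rw [← h.meet_eq, ← h.le_iff]
  exact h.d_le he k l p

theorem d_trans (h : 𝔄.IsLatticeGPHA) (he : e = true) (k l m : α) :
    𝔄.d he k l ⊓ 𝔄.d he l m ≤ 𝔄.d he k m := by
  obtain rfl | hkl := eq_or_ne k l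
  · exact inf_le_right
  · simpa [h.s_d, finApp_repl, hkl] using h.inf_d_le he l m (𝔄.d he k l)

variable [Infinite α]

theorem d_le_q_empty_d (h : 𝔄.IsLatticeGPHA) (he : e = true) (k l : α) :
    𝔄.d he k l ≤ 𝔄.q ∅ (𝔄.d he l k) := by
  classical
  obtain ⟨m, hm⟩ := Infinite.exists_notMem_finset ({k, l} : Finset α)
  obtain ⟨hmk, hml⟩ : m ≠ k ∧ m ≠ l := by simpa using hm
  have s_q (σ : FinTrans α) (p : A) : 𝔄.s σ (𝔄.q ∅ p) = 𝔄.q ∅ (𝔄.s σ p) :=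
    (h.q_s_eq p (by simp) (by simp)).symm
  have q_top : 𝔄.q ∅ ⊤ = ⊤ := by rw [← h.one_eq, (h.q_univ ∅).one]
  have replace_k : 𝔄.q ∅ (𝔄.d he k m) ⊓ 𝔄.d he k l ≤ 𝔄.q ∅ (𝔄.d he l m) := by
    simpa [s_q, h.s_d, finApp_repl, hmk] using h.inf_d_le he k l (𝔄.q ∅ (𝔄.d he k m))
  simpa [h.s_inf, s_q, h.s_d, finApp_repl, hmk.symm, hml.symm, h.d_self, q_top] using
    h.s_mono (FinTrans.repl m k) replace_k

theorem d_symm (h : 𝔄.IsLatticeGPHA) (he : e = true) (k l : α) : 𝔄.d he k l ≤ 𝔄.d he l k :=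
  (h.d_le_q_empty_d he k l).trans ((h.isQuantifierPair ∅).q_le _)

theorem c_empty_d (h : 𝔄.IsLatticeGPHA) (he : e = true) (k l : α) :
    𝔄.c ∅ (𝔄.d he k l) = 𝔄.d he k l :=
  h.c_eq_of_q_eq <| le_antisymm ((h.isQuantifierPair ∅).q_le _) <|
    (h.d_symm he k l).trans (h.d_le_q_empty_d he l k)

theorem c_d (h : 𝔄.IsLatticeGPHA) (he : e = true) {m k l : α} (hk : m ≠ k) (hl : m ≠ l) :
    𝔄.c {m} (𝔄.d he k l) = 𝔄.d he k l := by
  have hs : 𝔄.s (FinTrans.repl m k) (𝔄.d he k l) = 𝔄.d he k l := by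
    rw [h.s_d, finApp_repl, finApp_repl, if_neg hk.symm, if_neg hl.symm]
  have hm (i : α) : finApp (FinTrans.repl m k) i ∈ ({m} : Finset α) ↔ i ∈ (∅ : Finset α) := by
    rw [finApp_repl]
    split_ifs with hi <;> simp [hk.symm, hi]
  rw [← hs, h.c_s_eq _ (by simp) hm, h.c_empty_d]

end Diagonals

end IsLatticeGPHA

section DimensionComplemented

/-- A dimension complemented algebra: there are infinitely many coordinates on which none of the
elements of a given finite set depends. -/
def IsDimComplemented (𝔄 : PolyAlg e α A) : Prop :=
  ∀ T : Finset A, {k | ∀ t ∈ T, 𝔄.c {k} t = t}.Infinite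

theorem IsDimComplemented.infinite (hdim : 𝔄.IsDimComplemented) : Infinite α :=
  Set.infinite_univ_iff.1 (by simpa using hdim ∅)

theorem IsGPHA.exists_fresh_quantifier (h : 𝔄.IsGPHA) (hdim : 𝔄.IsDimComplemented) (T : Finset A)
    (J : Finset α) (σ : FinTrans α) (a : A) :
    ∃ (K : Finset α) (ν : FinTrans α), AgreeOff J ν σ ∧ (∀ t ∈ T, 𝔄.c K t = t) ∧
      𝔄.c K (𝔄.s ν a) = 𝔄.s σ (𝔄.c J a) ∧ 𝔄.q K (𝔄.s ν a) = 𝔄.s σ (𝔄.q J a) := by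
  classical
  obtain ⟨K, ν, ν', hK, hν, hν', hinj, hpre⟩ :=
    exists_agreeOff_fresh (hdim (insert a T)) J σ
  have fixed (t) (ht : t ∈ insert a T) : 𝔄.c K t = t := by
    obtain ⟨k, hk⟩ := (hdim {t}).nonempty
    exact h.c_eq_of_forall_mem (h.c_empty_eq_of_c_eq (hk t (Finset.mem_singleton_self t)))
      fun k hkK => hK hkK t ht
  have ha : 𝔄.c K a = a := fixed a (Finset.mem_insert_self a T)
  have hs : 𝔄.s ν a = 𝔄.s ν' a := h.s_eq_of_agreeOff ha hν'.symm
  have hσ : AgreeOff (J ∪ K) ν' σ := agreeOff_union_iff.2 ⟨ν, hν, hν'⟩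
  refine ⟨K, ν, hν, fun t ht => fixed t (Finset.mem_insert_of_mem ht), ?_, ?_⟩
  · calc 𝔄.c K (𝔄.s ν a) = 𝔄.s ν' (𝔄.c (J ∪ K) a) := by
          rw [hs, h.c_s_eq a hinj hpre, h.c_union, ha]
      _ = 𝔄.s σ (𝔄.c J a) := by rw [h.s_c ν' σ _ a hσ, h.c_union, ha]
  · calc 𝔄.q K (𝔄.s ν a) = 𝔄.s ν' (𝔄.q (J ∪ K) a) := by
          rw [hs, h.q_s_eq a hinj hpre, h.q_union, h.q_eq_of_c_eq ha]
      _ = 𝔄.s σ (𝔄.q J a) := by rw [h.s_q ν' σ _ a hσ, h.q_union, h.q_eq_of_c_eq ha]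

theorem IsGPHA.s_repl_s_modifyOn (h : 𝔄.IsGPHA) {a : A} {m : α} (ha : 𝔄.c {m} a = a)
    {σ : FinTrans α} (hσ : ∀ i, finApp σ i = m ↔ i = m) (k x : α) :
    𝔄.s (FinTrans.repl m x) (𝔄.s (modifyOn σ {k} fun _ => m) a) =
      𝔄.s (modifyOn σ {k} fun _ => x) a := by
  classical
  rw [← h.s_mul]
  refine h.s_eq_of_agreeOff ha fun i hi => ?_
  have him : finApp σ i ≠ m := mt (hσ i).1 (by simpa using hi)
  simp only [finApp_mul, finApp_modifyOn_singleton, finApp_repl]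
  split_ifs <;> simp_all

theorem IsLatticeGPHA.s_inf_d_le [HeytingAlgebra A] (h : 𝔄.IsLatticeGPHA)
    (hdim : 𝔄.IsDimComplemented) (he : e = true) (σ : FinTrans α) (k l : α) (a : A) :
    𝔄.s σ a ⊓ 𝔄.d he (finApp σ k) l ≤ 𝔄.s (modifyOn σ {k} fun _ => l) a := by
  classical
  obtain ⟨V, hV⟩ := exists_finset_apply_eq_iff σ
  obtain ⟨m, hm, hmV⟩ := (hdim {a}).exists_notMem_finset (insert l V)
  have ha : 𝔄.c {m} a = a := hm a (Finset.mem_singleton_self a)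
  obtain ⟨hml, hmV⟩ : m ≠ l ∧ m ∉ V := by simpa using hmV
  have restore (x : α) := h.s_repl_s_modifyOn ha (hV m hmV) k x
  set σm := modifyOn σ {k} fun _ => m
  calc 𝔄.s σ a ⊓ 𝔄.d he (finApp σ k) l
      = 𝔄.s (FinTrans.repl m (finApp σ k)) (𝔄.s σm a ⊓ 𝔄.d he m l) := by
        rw [h.s_inf, restore, modifyOn_singleton_self, h.s_d, finApp_repl, finApp_repl,
          if_pos rfl, if_neg hml.symm]
    _ ≤ 𝔄.s (FinTrans.repl m (finApp σ k)) (𝔄.s (FinTrans.repl m l) (𝔄.s σm a)) :=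
        h.s_mono _ (h.inf_d_le he m l _)
    _ = 𝔄.s (modifyOn σ {k} fun _ => l) a := by
        rw [← h.s_mul, repl_mul_repl _ hml, restore]

end DimensionComplemented

end PolyAlg

/-! ### The functional representation of an amalgam -/

namespace PolyAlg

variable {e : Bool} {α : Type u} {A : Type v} {𝔄 : PolyAlg e α A}

namespace IsLatticeGPHA

variable [HeytingAlgebra A]

/-- The subalgebra generated by `X`, as a subalgebra of the Heyting reduct. -/
def sgHeyting (h : 𝔄.IsLatticeGPHA) (X : Set A) : HeytingSubalgebra A where
  carrier := 𝔄.Sg X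
  supClosed' a ha b hb := h.join_eq a b ▸ .join a b ha hb
  infClosed' a ha b hb := h.meet_eq a b ▸ .meet a b ha hb
  bot_mem' := h.zero_eq ▸ .zero
  himp_mem' ha hb := h.imp_eq _ _ ▸ .imp _ _ ha hb

variable (h : 𝔄.IsLatticeGPHA) (X : Set A) (b : Bool)

theorem amalgamHom_s_c (hdim : 𝔄.IsDimComplemented) (J : Finset α) (σ : FinTrans α) (a : A) :
    (h.sgHeyting X).amalgamHom b (𝔄.s σ (𝔄.c J a)) =
      cyl J (fun ν => (h.sgHeyting X).amalgamHom b (𝔄.s ν a)) σ := by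
  classical
  refine le_antisymm ?_ (iSup₂_le fun ν hν => OrderHomClass.mono _ ?_)
  · rw [cyl, iSup_subtype']
    refine HeytingSubalgebra.amalgamHom_le_iSup b _ fun x y t => ?_
    obtain ⟨K, ν, hν, hT, hK, -⟩ := h.exists_fresh_quantifier hdim {x, y, t} J σ a
    exact ⟨⟨ν, hν⟩, 𝔄.c K, 𝔄.q K, h.isQuantifierPair K, fun i => .c K i, fun i => .q K i,
      hT x (by simp), hT y (by simp), hT t (by simp), hK.ge⟩
  · rw [← h.s_c ν σ J a hν]
    exact h.s_mono ν ((h.isQuantifierPair J).le_c a)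

theorem amalgamHom_s_q (hdim : 𝔄.IsDimComplemented) (J : Finset α) (σ : FinTrans α) (a : A) :
    (h.sgHeyting X).amalgamHom b (𝔄.s σ (𝔄.q J a)) =
      cocyl J (fun ν => (h.sgHeyting X).amalgamHom b (𝔄.s ν a)) σ := by
  classical
  refine le_antisymm (le_iInf₂ fun ν hν => OrderHomClass.mono _ ?_) ?_
  · rw [← h.s_q ν σ J a hν]
    exact h.s_mono ν ((h.isQuantifierPair J).q_le a)
  · rw [cocyl, iInf_subtype']
    refine HeytingSubalgebra.iInf_le_amalgamHom b _ fun x y => ?_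
    obtain ⟨K, ν, hν, hT, -, hK⟩ := h.exists_fresh_quantifier hdim {x, y} J σ a
    exact ⟨⟨ν, hν⟩, 𝔄.c K, 𝔄.q K, h.isQuantifierPair K, fun i => .q K i,
      hT x (by simp), hT y (by simp), hK.le⟩

section Infinite

variable [Infinite α]

/-- The diagonal elements of `𝔄`, with values in the amalgam over the subalgebra generated by `X`.
That subalgebra contains them, so it does not matter which copy of `𝔄` they are taken from. -/
def amalgamEquality : ValuedEquality e α (h.sgHeyting X).amalgam where
  val he k l := (h.sgHeyting X).amalgamHom true (𝔄.d he k l)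
  refl he k := by rw [h.d_self, map_top]
  symm he k l := OrderHomClass.mono _ (h.d_symm he k l)
  trans he k l m := by
    rw [← map_inf]
    exact OrderHomClass.mono _ (h.d_trans he k l m)

theorem amalgamHom_d (he : e = true) (k l : α) :
    (h.sgHeyting X).amalgamHom b (𝔄.d he k l) = (h.amalgamEquality X).val he k l :=
  HeytingSubalgebra.amalgamHom_eq_of_mem (S := h.sgHeyting X) (.d he k l) b true

theorem isExtensional_amalgamHom (hdim : 𝔄.IsDimComplemented) (a : A) :
    (h.amalgamEquality X).IsExtensional fun σ => (h.sgHeyting X).amalgamHom b (𝔄.s σ a) :=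
  .of_modifyOn_singleton fun he σ k l => by
    rw [← h.amalgamHom_d X b, ← map_inf]
    exact OrderHomClass.mono _ (h.s_inf_d_le hdim he σ k l a)

/-- The representation of `𝔄`, embedded into the amalgam as its copy `b`, by the functions
`σ ↦ s σ a` of a finite transformation. -/
def toExtensional (hdim : 𝔄.IsDimComplemented) (a : A) :
    {F : FinTrans α → (h.sgHeyting X).amalgam // (h.amalgamEquality X).IsExtensional F} :=
  ⟨fun σ => (h.sgHeyting X).amalgamHom b (𝔄.s σ a), h.isExtensional_amalgamHom X b hdim a⟩

theorem isHom_toExtensional (hdim : 𝔄.IsDimComplemented) :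
    𝔄.IsHom (h.amalgamEquality X).extensionalAlg (h.toExtensional X b hdim) where
  join p r := Subtype.ext <| funext fun σ =>
    (congrArg _ (((h.s_end σ).join p r).trans (h.join_eq _ _))).trans (map_sup _ _ _)
  meet p r := Subtype.ext <| funext fun σ =>
    (congrArg _ (((h.s_end σ).meet p r).trans (h.meet_eq _ _))).trans (map_inf _ _ _)
  imp p r := Subtype.ext <| funext fun σ =>
    (congrArg _ (((h.s_end σ).imp p r).trans (h.imp_eq _ _))).trans (map_himp _ _ _)
  zero := Subtype.ext <| funext fun σ =>
    (congrArg _ ((h.s_end σ).zero.trans h.zero_eq)).trans (map_bot _)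
  s τ a := Subtype.ext <| funext fun σ =>
    congrArg ((h.sgHeyting X).amalgamHom b) (h.s_mul σ τ a).symm
  c J a := Subtype.ext <| funext fun σ => h.amalgamHom_s_c X b hdim J σ a
  q J a := Subtype.ext <| funext fun σ => h.amalgamHom_s_q X b hdim J σ a
  d he k l := Subtype.ext <| funext fun σ =>
    (congrArg _ (h.s_d he σ k l)).trans (h.amalgamHom_d X b he _ _)

end Infinite

end IsLatticeGPHA

theorem IsGPHA.exists_isHom_pair_interpolating (h : 𝔄.IsGPHA) (hdim : 𝔄.IsDimComplemented)
    (X : Set A) :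
    ∃ (B : Type (max u v)) (𝔅 : PolyAlg e α B) (f g : A → B),
      𝔅.IsGPHA ∧ 𝔄.IsHom 𝔅 f ∧ 𝔄.IsHom 𝔅 g ∧ Set.EqOn f g (𝔄.Sg X) ∧
        ∀ a b, 𝔅.le (f a) (g b) → ∃ i ∈ 𝔄.Sg X, 𝔄.le a i ∧ 𝔄.le i b := by
  obtain ⟨_, h⟩ := h.exists_isLatticeGPHA
  have := hdim.infinite
  refine ⟨_, (h.amalgamEquality X).extensionalAlg, h.toExtensional X true hdim,
    h.toExtensional X false hdim, ValuedEquality.isGPHA_extensionalAlg _,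
    h.isHom_toExtensional X true hdim, h.isHom_toExtensional X false hdim, fun a ha => ?_,
    fun a b hab => ?_⟩
  · exact Subtype.ext <| funext fun σ =>
      HeytingSubalgebra.amalgamHom_eq_of_mem (S := h.sgHeyting X) (.s σ a ha) true false
  · have hab : (h.sgHeyting X).amalgamHom true (𝔄.s 1 a) ≤
        (h.sgHeyting X).amalgamHom (!true) (𝔄.s 1 b) :=
      ValuedEquality.extensionalAlg_le_iff.1 hab 1
    rw [h.s_one, h.s_one] at hab
    obtain ⟨i, hi, hai, hib⟩ := HeytingSubalgebra.exists_interpolant_of_amalgamHom_le hab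
    exact ⟨i, hi, h.le_iff.2 hai, h.le_iff.2 hib⟩

end PolyAlg

/-! ### The dimension-restricted free algebra -/

namespace PolyAlg

variable {e : Bool} {α : Type u} {A δ : Type*} {𝔄 : PolyAlg e α A}

open Filter

theorem IsGPHA.eventually_c_eq_of_mem_sg [Infinite α] (h : 𝔄.IsGPHA) {l : Filter α}
    (hl : l ≤ cofinite) {X : Set A} (hX : ∀ x ∈ X, ∀ᶠ k in l, 𝔄.c {k} x = x) {a : A}
    (ha : a ∈ 𝔄.Sg X) : ∀ᶠ k in l, 𝔄.c {k} a = a := by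
  obtain ⟨_, h⟩ := h.exists_isLatticeGPHA
  induction ha with
  | of x hx => exact hX x hx
  | join a b _ _ iha ihb =>
    filter_upwards [iha, ihb] with k ha hb
    rw [← ha, ← hb, (h.c_ex {k}).join]
  | meet a b _ _ iha ihb =>
    filter_upwards [iha, ihb] with k ha hb
    rw [← hb, (h.c_ex {k}).meet, ha]
  | imp a b _ _ iha ihb =>
    filter_upwards [iha, ihb] with k ha hb
    rw [← ha, ← hb, (h.c_ex {k}).imp]
  | zero => exact .of_forall fun k => (h.c_ex {k}).zero
  | s τ a _ ih =>
    obtain ⟨V, hV⟩ := exists_finset_apply_eq_iff τ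
    filter_upwards [ih, hl V.finite_toSet.compl_mem_cofinite] with k ha hk
    rw [h.c_s_eq (K := {k}) a (by simp) (by simpa using hV k hk), ha]
  | c J a _ ih => exact ih.mono fun k ha => by rw [h.c_comm, ha]
  | q J a _ ih =>
    exact ih.mono fun k ha => h.c_eq_of_q_eq (by rw [h.q_comm, h.q_eq_of_c_eq ha])
  | d he i j =>
    filter_upwards [hl (Set.toFinite {i, j}).compl_mem_cofinite] with k hk
    rw [Set.mem_compl_iff, Set.mem_insert_iff, Set.mem_singleton_iff, not_or] at hk
    exact h.c_d he hk.1 hk.2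

theorem IsGPHA.isDimComplemented (h : 𝔄.IsGPHA) {ρ : δ → Set α}
    (hρ : ∀ S : Finset δ, Set.Infinite (⋃ η ∈ S, ρ η)ᶜ) {x : δ → A}
    (hx : ∀ η k, k ∉ ρ η → 𝔄.c {k} (x η) = x η) (hgen : 𝔄.Sg (Set.range x) = Set.univ) :
    𝔄.IsDimComplemented := fun T => by
  classical
  have : Infinite α := Set.infinite_univ_iff.1 (by simpa using hρ ∅)
  let l : Filter α := ⨅ S : Finset δ, cofinite ⊓ 𝓟 (⋃ η ∈ S, ρ η)ᶜ
  have l_le (S : Finset δ) : l ≤ cofinite ⊓ 𝓟 (⋃ η ∈ S, ρ η)ᶜ := iInf_le _ S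
  have hl : l ≤ cofinite := (l_le ∅).trans inf_le_left
  have : l.NeBot := by
    refine iInf_neBot_of_directed' (Antitone.directed_ge fun S S' hS => ?_) fun S =>
      (hρ S).cofinite_inf_principal_neBot
    exact inf_le_inf_left _ (principal_mono.2 (Set.compl_subset_compl.2
      (Set.biUnion_subset_biUnion_left hS)))
  have fixed (a : A) : ∀ᶠ k in l, 𝔄.c {k} a = a := by
    refine h.eventually_c_eq_of_mem_sg hl ?_ (hgen ▸ Set.mem_univ a)
    rintro _ ⟨η, rfl⟩
    filter_upwards [(l_le {η}).trans inf_le_right (mem_principal_self _)] with k hk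
    exact hx η k (by simpa using hk)
  exact frequently_cofinite_iff_infinite.1
    (((eventually_all_finset T).2 fun t _ => fixed t).frequently.filter_mono hl)

end PolyAlg

section DimensionRestrictedFreeAlgebra

variable {e : Bool} {α : Type u} {δ B : Type*} {ρ : δ → Set α}

/-- The value of a word in `𝔅` when the variables take the values `f`. -/
def PolyWord.eval (𝔅 : PolyAlg e α B) (f : δ → B) : PolyWord e α δ → B
  | .var η => f η
  | .join a b => 𝔅.join (a.eval 𝔅 f) (b.eval 𝔅 f)
  | .meet a b => 𝔅.meet (a.eval 𝔅 f) (b.eval 𝔅 f)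
  | .imp a b => 𝔅.imp (a.eval 𝔅 f) (b.eval 𝔅 f)
  | .zero => 𝔅.zero
  | .s τ a => 𝔅.s τ (a.eval 𝔅 f)
  | .c J a => 𝔅.c J (a.eval 𝔅 f)
  | .q J a => 𝔅.q J (a.eval 𝔅 f)
  | .d he k l => 𝔅.d he k l

theorem PolyWord.isHom_eval (𝔅 : PolyAlg e α B) (f : δ → B) :
    (absFree e α δ).IsHom 𝔅 (PolyWord.eval 𝔅 f) where
  join _ _ := rfl
  meet _ _ := rfl
  imp _ _ := rfl
  zero := rfl
  s _ _ := rfl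
  c _ _ := rfl
  q _ _ := rfl
  d _ _ _ := rfl

variable (e ρ) in
theorem isGPHA_dimFree : (dimFree e ρ).IsGPHA := by
  have hom (R : {R // IsRestrictedCon e ρ R}) : (dimFree e ρ).IsHom
      ((absFree e α δ).quot R.1 R.2.1)
      (Quotient.lift (Quotient.mk R.1) fun _ _ hab => Quotient.sound (hab R.1 R.2)) :=
    ((absFree e α δ).isHom_quotientMk R.2.1).quotientLift (restrictedCr_isCon e ρ) _
  refine PolyAlg.isGPHA_of_jointly_injective hom ?_ fun R => R.2.2.1
  rintro ⟨a⟩ ⟨b⟩ hab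
  exact Quotient.sound fun R hR => Quotient.exact (hab ⟨R, hR⟩)

namespace DimFree

variable (e ρ) in
theorem c_gen (η : δ) (k : α) (hk : k ∉ ρ η) : (dimFree e ρ).c {k} (gen e ρ η) = gen e ρ η :=
  Quotient.sound fun _ ⟨_, _, hR⟩ => hR η k hk

variable (e ρ) in
theorem sg_range_gen : (dimFree e ρ).Sg (Set.range (gen e ρ)) = Set.univ := by
  refine Set.eq_univ_of_forall (Quotient.ind fun w => ?_)
  induction w with
  | var η => exact .of _ ⟨η, rfl⟩
  | join a b iha ihb => exact .join _ _ iha ihb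
  | meet a b iha ihb => exact .meet _ _ iha ihb
  | imp a b iha ihb => exact .imp _ _ iha ihb
  | zero => exact .zero
  | s τ a ih => exact .s τ _ ih
  | c J a ih => exact .c J _ ih
  | q J a ih => exact .q J _ ih
  | d he k l => exact .d he k l

theorem isDimComplemented (hρ : ∀ S : Finset δ, Set.Infinite (⋃ η ∈ S, ρ η)ᶜ) :
    (dimFree e ρ).IsDimComplemented :=
  (isGPHA_dimFree e ρ).isDimComplemented hρ (c_gen e ρ) (sg_range_gen e ρ)

theorem exists_isHom_gen_eq {𝔅 : PolyAlg e α B} (h : 𝔅.IsGPHA) (f : δ → B)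
    (hf : ∀ η k, k ∉ ρ η → 𝔅.c {k} (f η) = f η) :
    ∃ Φ : DimFree e ρ → B, (dimFree e ρ).IsHom 𝔅 Φ ∧ ∀ η, Φ (gen e ρ η) = f η := by
  have eval := PolyWord.isHom_eval 𝔅 f
  have restricted : IsRestrictedCon e ρ (Setoid.ker (PolyWord.eval 𝔅 f)) :=
    ⟨eval.isCon_ker, eval.isGPHA_quot_ker h, hf⟩
  exact ⟨_, eval.quotientLift (restrictedCr_isCon e ρ) fun _ _ hab => hab _ restricted,
    fun _ => rfl⟩

end DimFree

end DimensionRestrictedFreeAlgebra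

theorem mainTheorem3 (e : Bool) {α : Type*} [Infinite α] {δ : Type*} (ρ : δ → Set α)
    (hρ : ∀ S : Finset δ, Set.Infinite (⋃ η ∈ S, ρ η)ᶜ)
    (X₁ X₂ : Set (DimFree e ρ))
    (hX₁ : X₁ ⊆ Set.range (DimFree.gen e ρ)) (hX₂ : X₂ ⊆ Set.range (DimFree.gen e ρ))
    (θ₁ θ₂ : DimFree e ρ)
    (hθ₁ : θ₁ ∈ (dimFree e ρ).Sg X₁) (hθ₂ : θ₂ ∈ (dimFree e ρ).Sg X₂)
    (hle : (dimFree e ρ).le θ₁ θ₂) :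
    ∃ θ ∈ (dimFree e ρ).Sg (X₁ ∩ X₂), (dimFree e ρ).le θ₁ θ ∧ (dimFree e ρ).le θ θ₂ := by
  classical
  obtain ⟨B, 𝔅, f, g, h𝔅, hf, hg, hfg, interpolate⟩ :=
    (isGPHA_dimFree e ρ).exists_isHom_pair_interpolating (DimFree.isDimComplemented hρ) (X₁ ∩ X₂)
  let assign (x : DimFree e ρ) : B := if x ∈ X₁ then f x else g x
  have assign_X₁ : Set.EqOn assign f X₁ := fun x hx => if_pos hx
  have assign_X₂ : Set.EqOn assign g X₂ := fun x hx => by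
    by_cases hx₁ : x ∈ X₁
    · exact (if_pos hx₁).trans (hfg (.of x ⟨hx₁, hx⟩))
    · exact if_neg hx₁
  obtain ⟨Φ, hΦ, Φ_gen⟩ := DimFree.exists_isHom_gen_eq (ρ := ρ) h𝔅
    (fun η => assign (DimFree.gen e ρ η)) fun η k hk => by
      dsimp only [assign]
      split_ifs
      exacts [by rw [← hf.c, DimFree.c_gen e ρ η k hk], by rw [← hg.c, DimFree.c_gen e ρ η k hk]]
  have Φ_assign : Set.EqOn Φ assign (Set.range (DimFree.gen e ρ)) := by
    rintro _ ⟨η, rfl⟩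
    exact Φ_gen η
  have Φ_θ₁ : Φ θ₁ = f θ₁ := hΦ.eqOn_sg hf ((Φ_assign.mono hX₁).trans assign_X₁) hθ₁
  have Φ_θ₂ : Φ θ₂ = g θ₂ := hΦ.eqOn_sg hg ((Φ_assign.mono hX₂).trans assign_X₂) hθ₂
  exact interpolate θ₁ θ₂ (Φ_θ₁ ▸ Φ_θ₂ ▸ hΦ.le hle)
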